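/- A \emph{sandpile} $S$ is a finite connected loopless multigraph with a distinguished vertex $s$ (the sink) which stays connected and non-empty when $s$ is removed. A configuration assigns a number of particles to every non-sink vertex; a non-sink vertex $v$ holding at least $\deg(v)$ particles is unstable and may topple, sending one particle along each incident edge (particles sent to $s$ are lost). A configuration is \emph{recurrent} if it can be reached from every configuration by adding particles and then toppling unstable vertices. The \emph{transience class} $\mathrm{tcl}(S)\in\mathbb N\cup\{\infty\}$ is the maximal number of particles that can be added one by one to the empty configuration, stabilizing after each addition, before a recurrent configuration is reached. A family $\{S_n\}_{n\in\mathbb N}$ belongs to $TCL(\mathrm{poly}(n))$ if $\mathrm{tcl}(S_n)=O(n^k)$ for some $k$. For a vertex $w\ne s$, the potential $\pi_w$ of $S$ is the function with $\pi_w(s)=0$, $\pi_w(w)=1$ that is harmonic at all other vertices (unit resistance on every edge). Two sandpiles are \emph{network equivalent}, $S_1\sim_e S_2$, if their boundary sets (the vertices adjacent to the sink) can be identified so that $\pi_v(w)$ is the same in both for all boundary vertices $v,w$. (1) Let $\{A_n\}$, $\{B_n\}$ be families of sandpiles whose numbers of edges are bounded by polynomials in $n$. If $A_n\sim_e B_n$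 for all $n$, then $\{A_n\}\in TCL(\mathrm{poly}(n))$ if and only if $\{B_n\}\in TCL(\mathrm{poly}(n))$. (2) Let $L\sqcup R$ be the bipartition of the honeycomb lattice: $L$ is the vertex set of a triangular lattice, and each $q\in R$ is the centre of a star whose three leaves form an elementary triangle of $L$, every edge of the triangular lattice lying in exactly one of these triangles. For a finite set $F$ of vertices inducing a connected subgraph of the honeycomb lattice let $H_F$ be the sandpile on $F$ in which every lattice edge leaving $F$ is connected to the sink. For an integer $r\ge1$ let $T^{(r)}_F$ be the multigraph with sink on $F\cap L$ obtained from $H_F$ by replacing every star with centre in $F\cap R$ by the triangle on its leaves (leaves outside $F$ being the sink; edges from the sink to itself are dropped), and every remaining edge, from a vertex of $F\cap L$ to the sink, by $r$ parallel edges. Then: (a) For every such $F$ and all $v,w\in F\cap L$, the potential $\pi_w(v)$ is the same in $H_F$ and in $T^{(3)}_F$. (b) For every sequence $(F_n)$ of such sets and every fixed $r\ge 1$, $\{H_{F_n}\}\in TCL(\mathrm{poly}(n))$ if and only if $\{T^{(r)}_{F_n}\}\in TCL(\mathrm{poly}(n))$. (c) If moreover every centre $q\in R$ with at least two leaves in $F_n$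 belongs to $F_n$, for all $n$, then $\{H_{F_n}\}\in TCL(\mathrm{poly}(n))$ if and only if $\{T_n\}\in TCL(\mathrm{poly}(n))$, where $T_n$ is the sandpile on the section $F_n\cap L$ of the triangular lattice in which every lattice edge leaving the section is connected to the sink. -/

import Mathlib

/-- A finite multigraph without loops on the vertex set `V`, with a distinguished vertex, the sink.
`mult u v` is the number of parallel edges joining `u` and `v`. -/
structure SinkGraph (V : Type*) where
  mult : V → V → ℕ
  mult_comm : ∀ u v, mult u v = mult v u
  mult_self : ∀ v, mult v v = 0
  sink : V

namespace SinkGraph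

variable {V : Type*}

/-- The simple graph of adjacency. -/
def adjGraph (S : SinkGraph V) : SimpleGraph V where
  Adj u v := 0 < S.mult u v
  symm := ⟨fun u v h => by rw [S.mult_comm v u]; exact h⟩
  loopless := ⟨fun v h => by rw [S.mult_self v] at h; exact absurd h (lt_irrefl 0)⟩

/-- The underlying graph of a sandpile is connected. -/
def IsConnected (S : SinkGraph V) : Prop := S.adjGraph.Connected

/-- The ordinary (non-sink) vertices. -/
abbrev Site (S : SinkGraph V) : Type _ := {v : V // v ≠ S.sink}

/-- The graph stays connected (and non-empty) after the removal of the sink. -/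
def OrdinaryConnected (S : SinkGraph V) : Prop :=
  (S.adjGraph.induce {v | v ≠ S.sink}).Connected

/-- The boundary set: the vertices adjacent to the sink. -/
abbrev Boundary (S : SinkGraph V) : Type _ := {v : V // 0 < S.mult v S.sink}

section Finite

variable [Fintype V]

/-- The degree, counting parallel edges. -/
def degree (S : SinkGraph V) (v : V) : ℕ := ∑ u, S.mult v u

/-- The number of edges, counting parallel edges (half the sum of the degrees). -/
def numEdges (S : SinkGraph V) : ℕ := (∑ v, S.degree v) / 2

/-! ### Potentials -/

/-- `p` is the potential that appears in the circuit with a unit resistor on every edge when unit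
potential is applied at `w` and the sink is grounded: `p` is harmonic at all other vertices. -/
def IsPotential (S : SinkGraph V) (w : V) (p : V → ℝ) : Prop :=
  p S.sink = 0 ∧ p w = 1 ∧
    ∀ v, v ≠ S.sink → v ≠ w → ∑ u, (S.mult v u : ℝ) * p u = (S.degree v : ℝ) * p v

/-- Network equivalence: after an identification of the two boundary sets, unit potential applied
at any boundary vertex (with the sink grounded) produces the same potentials at all boundary
vertices. -/
def NetworkEquiv {W : Type*} [Fintype W] (S : SinkGraph V) (T : SinkGraph W) : Prop :=
  ∃ e : S.Boundary ≃ T.Boundary, ∀ v : S.Boundary, ∃ (p : V → ℝ) (q : W → ℝ),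
    S.IsPotential v.1 p ∧ T.IsPotential (e v).1 q ∧ ∀ w : S.Boundary, p w.1 = q (e w).1

/-! ### The abelian sandpile model -/

variable [DecidableEq V]

/-- A configuration: the number of particles at each ordinary vertex. -/
abbrev Config (S : SinkGraph V) : Type _ := S.Site → ℕ

/-- The site `v` is unstable. -/
def Unstable (S : SinkGraph V) (c : S.Config) (v : S.Site) : Prop := S.degree v.1 ≤ c v

/-- No site is unstable. -/
def IsStable (S : SinkGraph V) (c : S.Config) : Prop := ∀ v, ¬ S.Unstable c v

/-- Toppling `v`: it loses `degree v` particles, one along each incident edge. -/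
def topple (S : SinkGraph V) (c : S.Config) (v : S.Site) : S.Config :=
  fun u => if u = v then c v - S.degree v.1 else c u + S.mult v.1 u.1

/-- `d` arises from `c` by toppling one unstable site. -/
def ToppleStep (S : SinkGraph V) (c d : S.Config) : Prop :=
  ∃ v, S.Unstable c v ∧ d = S.topple c v

/-- There is a (possibly empty) toppling sequence from `c` to `d`. -/
def TopplesTo (S : SinkGraph V) : S.Config → S.Config → Prop :=
  Relation.ReflTransGen S.ToppleStep

/-- `d` is reachable from `c` by adding particles and toppling. -/
def Reachable (S : SinkGraph V) (c d : S.Config) : Prop :=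
  ∃ c', c ≤ c' ∧ S.TopplesTo c' d

/-- A configuration is recurrent if it is reachable from every configuration. -/
def IsRecurrent (S : SinkGraph V) (c : S.Config) : Prop := ∀ c', S.Reachable c' c

/-- `TransientRun k c`: starting from the empty configuration, `k` particles can be added one by
one, at sites of our choice and stabilizing after each addition, so that no recurrent configuration
has been met and the present stable configuration is `c`. -/
inductive TransientRun (S : SinkGraph V) : ℕ → S.Config → Prop
  | empty : ¬ S.IsRecurrent 0 → TransientRun S 0 0
  | add {k : ℕ} {c d : S.Config} (v : S.Site) : TransientRun S k c →
      S.TopplesTo (c + Pi.single v 1) d → S.IsStable d → ¬ S.IsRecurrent d →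
      TransientRun S (k + 1) d

/-- The transience class: the maximal number of particles that can be added before a recurrent
configuration is reached (`⊤` if there is no bound). -/
noncomputable def tcl (S : SinkGraph V) : ℕ∞ :=
  ⨆ k ∈ {k : ℕ | ∃ c, S.TransientRun k c}, (k : ℕ∞)

end Finite

/-! ### Families -/

section Family

variable {V : ℕ → Type*} [∀ n, Fintype (V n)]

/-- The numbers of edges of the family are bounded by a polynomial in the index. -/
def PolySize (S : ∀ n, SinkGraph (V n)) : Prop :=
  ∃ k C : ℕ, ∀ᶠ n in Filter.atTop, (S n).numEdges ≤ C * n ^ k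

variable [∀ n, DecidableEq (V n)]

/-- The family belongs to `TCL(f(n))`: `tcl (S n) = O(f n)`. -/
def InTCL (S : ∀ n, SinkGraph (V n)) (f : ℕ → ℕ) : Prop :=
  ∃ C : ℕ, ∀ᶠ n in Filter.atTop, (S n).tcl ≤ ((C * f n : ℕ) : ℕ∞)

/-- The family belongs to `TCL(poly(n))`. -/
def InTCLPoly (S : ∀ n, SinkGraph (V n)) : Prop := ∃ k : ℕ, InTCL S (fun n => n ^ k)

end Family

end SinkGraph

/-! ### The honeycomb and the triangular lattice -/

/-- The vertices of the honeycomb lattice. The two classes of the bipartition are two copies of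
`ℤ × ℤ`. The left copy is a triangular lattice, and each vertex of the right copy is the centre of
a star with three leaves in the left copy. -/
abbrev HoneycombSite : Type := (ℤ × ℤ) ⊕ (ℤ × ℤ)

/-- The three leaves of the star with centre `q`: an elementary triangle of the triangular
lattice. -/
def starLeaves (q : ℤ × ℤ) : Finset (ℤ × ℤ) := {q, q + (1, 0), q + (0, 1)}

/-- The three centres of the stars with `p` as a leaf. -/
def starCentres (p : ℤ × ℤ) : Finset (ℤ × ℤ) := {p, p - (1, 0), p - (0, 1)}

theorem mem_starCentres_iff (p q : ℤ × ℤ) : q ∈ starCentres p ↔ p ∈ starLeaves q := by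
  obtain ⟨a, b⟩ := p
  obtain ⟨c, d⟩ := q
  simp only [starCentres, starLeaves, Finset.mem_insert, Finset.mem_singleton, Prod.mk.injEq,
    Prod.mk_add_mk, Prod.mk_sub_mk]
  omega

/-- The three neighbours of a vertex in the honeycomb lattice. -/
def honeycombNbrs : HoneycombSite → Finset HoneycombSite
  | .inl p => (starCentres p).map Function.Embedding.inr
  | .inr q => (starLeaves q).map Function.Embedding.inl

theorem honeycombNbrs_comm (u v : HoneycombSite) :
    v ∈ honeycombNbrs u ↔ u ∈ honeycombNbrs v := by
  rcases u with p | q <;> rcases v with p' | q' <;>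
    simp [honeycombNbrs, mem_starCentres_iff]

theorem honeycombNbrs_self (u : HoneycombSite) : u ∉ honeycombNbrs u := by
  rcases u with p | q <;> simp [honeycombNbrs]

/-- The honeycomb lattice. -/
def honeycomb : SimpleGraph HoneycombSite where
  Adj u v := v ∈ honeycombNbrs u
  symm := ⟨fun u v h => (honeycombNbrs_comm u v).1 h⟩
  loopless := ⟨honeycombNbrs_self⟩

/-- The six neighbours of a point in the triangular lattice. -/
def triangularNbrs (p : ℤ × ℤ) : Finset (ℤ × ℤ) :=
  {p + (1, 0), p - (1, 0), p + (0, 1), p - (0, 1), p + (1, -1), p - (1, -1)}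

theorem triangularNbrs_comm (p q : ℤ × ℤ) : q ∈ triangularNbrs p ↔ p ∈ triangularNbrs q := by
  obtain ⟨a, b⟩ := p
  obtain ⟨c, d⟩ := q
  simp only [triangularNbrs, Finset.mem_insert, Finset.mem_singleton, Prod.mk.injEq,
    Prod.mk_add_mk, Prod.mk_sub_mk]
  omega

theorem triangularNbrs_self (p : ℤ × ℤ) : p ∉ triangularNbrs p := by
  obtain ⟨a, b⟩ := p
  simp only [triangularNbrs, Finset.mem_insert, Finset.mem_singleton, Prod.mk.injEq,
    Prod.mk_add_mk, Prod.mk_sub_mk]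
  omega

/-- The sandpile with site set `X` and sink `none`, given the edges between sites and the number of
edges from each site to the sink. -/
def SinkGraph.ofSites {X : Type*} (m : X → X → ℕ) (t : X → ℕ)
    (hm : ∀ x y, m x y = m y x) (h0 : ∀ x, m x x = 0) : SinkGraph (Option X) where
  mult
    | some x, some y => m x y
    | some x, none => t x
    | none, some y => t y
    | none, none => 0
  mult_comm u v := by cases u <;> cases v <;> simp [hm]
  mult_self v := by cases v <;> simp [h0]
  sink := none

/-- The honeycomb sandpile on the finite section `F` of the honeycomb lattice: the edges that leave
`F` are connected to the sink. -/
def honeycombSandpile (F : Finset HoneycombSite) : SinkGraph (Option F) :=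
  SinkGraph.ofSites (fun u v => if v.1 ∈ honeycombNbrs u.1 then 1 else 0)
    (fun u => ((honeycombNbrs u.1).filter (· ∉ F)).card)
    (fun u v => by simp [honeycombNbrs_comm u.1 v.1])
    (fun u => by simp [honeycombNbrs_self])

/-- The triangular sandpile on the finite section `P` of the triangular lattice: the edges that
leave `P` are connected to the sink. -/
def triangularSandpile (P : Finset (ℤ × ℤ)) : SinkGraph (Option P) :=
  SinkGraph.ofSites (fun u v => if v.1 ∈ triangularNbrs u.1 then 1 else 0)
    (fun u => ((triangularNbrs u.1).filter (· ∉ P)).card)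
    (fun u v => by simp [triangularNbrs_comm u.1 v.1])
    (fun u => by simp [triangularNbrs_self])

/-- The sandpile obtained from `honeycombSandpile F` by the star-delta transformation. Every star
whose centre lies in `F` is replaced by the triangle on its three leaves (leaves outside `F` being
the sink), with one edge for each side. The edges that belong to no such star are those that join a
left vertex of `F` to the sink in place of a centre outside `F`; each of them is replaced by
`r` parallel edges. -/
def starDeltaSandpile (r : ℕ) (F : Finset HoneycombSite) : SinkGraph (Option F.toLeft) :=
  SinkGraph.ofSites
    (fun u v => if u = v then 0 else
      (F.toRight.filter (fun q => u.1 ∈ starLeaves q ∧ v.1 ∈ starLeaves q)).card)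
    (fun u => ∑ q ∈ starCentres u.1,
      if q ∈ F.toRight then ((starLeaves q).filter (· ∉ F.toLeft)).card else r)
    (fun u v => by simp only [eq_comm (a := u), and_comm (a := u.1 ∈ _)])
    (fun u => by simp)

/-!
A potential `p` is superharmonic off the sink, so toppling does not increase the weight
`∑ v, c v * p v` of a configuration. If `tcl S ≤ K`, then `K + 1` particles dropped at `v` lead to
a recurrent configuration, which by Dhar's burning condition cannot vanish at both ends of an edge;
hence its weight against `π_w`, and thereby `π_w v`, is bounded below. Conversely, as long as some
site `w` has not toppled, the weight against `π_w` gains `π_w v` with every particle added at `v`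
and loses nothing, so a lower bound on the potentials bounds `tcl S`. The transience class is
therefore polynomial exactly when the potentials are polynomially bounded below.

Such a bound can be checked at the boundary alone: the minimum of `π_w` off the sink is attained at
`w` or at the boundary, and reciprocity exchanges `w` with a boundary vertex. This is network
equivalence.

The star-delta transformation preserves the potentials at the leaves. The number `r` of edges
replacing each remaining edge to the sink matters only polynomially: by convexity, if `p` is
harmonic for one edge then `p ^ r` is subharmonic for `r` edges, so the new potential lies between
`p ^ r` and `p`.
-/

namespace SinkGraph

open Finset

/-! ### Potential theory -/

section Laplacian

variable {V : Type*} [Fintype V] {S : SinkGraph V}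

/-- The combinatorial Laplacian: `S.laplacian f v` is the net current that leaves `v` when `f`
gives the voltages. -/
def laplacian (S : SinkGraph V) : (V → ℝ) →ₗ[ℝ] V → ℝ where
  toFun f v := ∑ u, (S.mult v u : ℝ) * (f v - f u)
  map_add' f g := by
    ext v
    simp only [Pi.add_apply, ← sum_add_distrib]
    exact sum_congr rfl fun u _ => by ring
  map_smul' a f := by
    ext v
    simp only [Pi.smul_apply, smul_eq_mul, RingHom.id_apply, mul_sum]
    exact sum_congr rfl fun u _ => by ring

theorem laplacian_apply (S : SinkGraph V) (f : V → ℝ) (v : V) :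
    S.laplacian f v = ∑ u, (S.mult v u : ℝ) * (f v - f u) := rfl

theorem laplacian_eq_degree_mul_sub (S : SinkGraph V) (f : V → ℝ) (v : V) :
    S.laplacian f v = S.degree v * f v - ∑ u, (S.mult v u : ℝ) * f u := by
  simp only [laplacian_apply, degree, Nat.cast_sum, sum_mul, ← sum_sub_distrib, mul_sub]

theorem two_mul_sum_mul_laplacian (S : SinkGraph V) (f g : V → ℝ) :
    2 * ∑ v, f v * S.laplacian g v =
      ∑ v, ∑ u, (S.mult v u : ℝ) * ((f v - f u) * (g v - g u)) := by
  have outgoing : ∑ v, f v * S.laplacian g v =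
      ∑ v, ∑ u, (S.mult v u : ℝ) * (f v * (g v - g u)) := by
    simp only [laplacian_apply, mul_sum, mul_left_comm]
  have incoming : ∑ v, f v * S.laplacian g v =
      ∑ v, ∑ u, (S.mult v u : ℝ) * (f u * (g u - g v)) := by
    rw [outgoing, sum_comm]
    simp only [S.mult_comm]
  rw [two_mul]
  nth_rewrite 1 [outgoing]
  rw [incoming]
  simp only [← sum_add_distrib]
  exact sum_congr rfl fun v _ => sum_congr rfl fun u _ => by ring

theorem sum_mul_laplacian_comm (S : SinkGraph V) (f g : V → ℝ) :
    ∑ v, f v * S.laplacian g v = ∑ v, g v * S.laplacian f v := by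
  refine mul_left_cancel₀ two_ne_zero ?_
  simp only [two_mul_sum_mul_laplacian, mul_comm (f _ - f _)]

/-- The Dirichlet energy: the sum of `(f v - f u) ^ 2` over the edges `uv`. -/
def energy (S : SinkGraph V) (f : V → ℝ) : ℝ := ∑ v, f v * S.laplacian f v

theorem sq_sub_le_energy (f : V → ℝ) {a b : V} (hab : S.adjGraph.Adj a b) :
    (f a - f b) ^ 2 ≤ S.energy f := by
  have hmult : (1 : ℝ) ≤ S.mult a b := by exact_mod_cast (show 0 < S.mult a b from hab)
  have hE : 2 * S.energy f = ∑ e : V × V, (S.mult e.1 e.2 : ℝ) * (f e.1 - f e.2) ^ 2 := by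
    simp only [energy, two_mul_sum_mul_laplacian, Fintype.sum_prod_type, ← sq]
  have hpair : (S.mult a b : ℝ) * (f a - f b) ^ 2 + (S.mult b a : ℝ) * (f b - f a) ^ 2 ≤
      2 * S.energy f := by
    rw [hE]
    exact add_le_sum (f := fun e : V × V => (S.mult e.1 e.2 : ℝ) * (f e.1 - f e.2) ^ 2)
      (i := (a, b)) (j := (b, a)) (fun e _ => by positivity) (mem_univ _) (mem_univ _)
      fun h => hab.ne (congrArg Prod.fst h)
  rw [S.mult_comm b a] at hpair
  nlinarith [sq_nonneg (f a - f b)]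

theorem sub_le_length_mul_sqrt_energy (f : V → ℝ) {a b : V} (W : S.adjGraph.Walk a b) :
    f a - f b ≤ W.length * √(S.energy f) := by
  induction W with
  | nil => simp
  | cons hadj W ih =>
    have hstep := Real.le_sqrt_of_sq_le (sq_sub_le_energy f hadj)
    rw [SimpleGraph.Walk.length_cons]
    push_cast
    linarith

theorem eq_of_adj_of_forall_le {f : V → ℝ} {x u : V} (hx : ∀ y, f x ≤ f y)
    (hf : 0 ≤ S.laplacian f x) (hxu : S.adjGraph.Adj x u) : f u = f x := by
  have hterm : ∀ y ∈ univ, (S.mult x y : ℝ) * (f x - f y) ≤ 0 := fun y _ =>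
    mul_nonpos_of_nonneg_of_nonpos (Nat.cast_nonneg _) (sub_nonpos.2 (hx y))
  have hzero := (sum_eq_zero_iff_of_nonpos hterm).1 (le_antisymm (sum_nonpos hterm) hf) u
    (mem_univ u)
  have hmult : (S.mult x u : ℝ) ≠ 0 := Nat.cast_ne_zero.2 (Nat.pos_iff_ne_zero.1 hxu)
  exact (sub_eq_zero.1 ((mul_eq_zero.1 hzero).resolve_left hmult)).symm

theorem nonneg_of_laplacian_nonneg (hS : S.IsConnected) {Z : Set V} {f : V → ℝ}
    (hs : S.sink ∈ Z) (hZ : ∀ v ∈ Z, 0 ≤ f v) (hf : ∀ v ∉ Z, 0 ≤ S.laplacian f v) (v : V) :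
    0 ≤ f v := by
  have : Nonempty V := ⟨v⟩
  obtain ⟨x, hx⟩ := Finite.exists_min f
  by_contra! hv
  have hx0 : f x < 0 := (hx v).trans_lt hv
  obtain ⟨W⟩ := hS.preconnected x S.sink
  obtain ⟨d, -, hfst, hsnd⟩ := W.exists_boundary_dart {y | f y = f x} rfl
    fun h => (hZ _ hs).not_gt (h.trans_lt hx0)
  have hfst : f d.fst = f x := hfst
  have hdZ : d.fst ∉ Z := fun h => (hZ _ h).not_gt (hfst.trans_lt hx0)
  exact hsnd ((eq_of_adj_of_forall_le (hfst ▸ hx) (hf _ hdZ) d.adj).trans hfst)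

theorem le_of_laplacian_le (hS : S.IsConnected) {Z : Set V} {f g : V → ℝ} (hs : S.sink ∈ Z)
    (hZ : ∀ v ∈ Z, f v ≤ g v) (hfg : ∀ v ∉ Z, S.laplacian f v ≤ S.laplacian g v) (v : V) :
    f v ≤ g v := by
  have h := nonneg_of_laplacian_nonneg (f := g - f) hS hs (fun v hv => sub_nonneg.2 (hZ v hv))
    (fun v hv => by simpa only [map_sub, Pi.sub_apply, sub_nonneg] using hfg v hv) v
  exact sub_nonneg.1 h

theorem eq_of_laplacian_eq (hS : S.IsConnected) {Z : Set V} {f g : V → ℝ} (hs : S.sink ∈ Z)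
    (hZ : ∀ v ∈ Z, f v = g v) (hfg : ∀ v ∉ Z, S.laplacian f v = S.laplacian g v) : f = g :=
  funext fun v => le_antisymm
    (le_of_laplacian_le hS hs (fun v hv => (hZ v hv).le) (fun v hv => (hfg v hv).le) v)
    (le_of_laplacian_le hS hs (fun v hv => (hZ v hv).ge) (fun v hv => (hfg v hv).ge) v)

/-- Uniqueness makes the linear system of the Dirichlet problem injective, hence surjective. -/
theorem exists_laplacian_eq (hS : S.IsConnected) {Z : Set V} (hs : S.sink ∈ Z) (g : V → ℝ) :
    ∃ f : V → ℝ, (∀ v ∈ Z, f v = g v) ∧ ∀ v ∉ Z, S.laplacian f v = g v := by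
  classical
  let T : (V → ℝ) →ₗ[ℝ] V → ℝ := LinearMap.pi fun v =>
    if v ∈ Z then LinearMap.proj v else LinearMap.proj v ∘ₗ S.laplacian
  have hT_mem : ∀ f, ∀ v ∈ Z, T f v = f v := fun f v hv => by simp [T, hv]
  have hT_notMem : ∀ f, ∀ v ∉ Z, T f v = S.laplacian f v := fun f v hv => by simp [T, hv]
  have hinj : Function.Injective T := fun f g hfg => eq_of_laplacian_eq hS hs
    (fun v hv => by rw [← hT_mem f v hv, hfg, hT_mem g v hv])
    (fun v hv => by rw [← hT_notMem f v hv, hfg, hT_notMem g v hv])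
  obtain ⟨f, rfl⟩ := LinearMap.injective_iff_surjective.1 hinj g
  exact ⟨f, fun v hv => (hT_mem f v hv).symm, fun v hv => (hT_notMem f v hv).symm⟩

theorem degree_pos (hS : S.IsConnected) {v u : V} (hvu : v ≠ u) : 0 < S.degree v := by
  have : Nontrivial V := ⟨⟨v, u, hvu⟩⟩
  obtain ⟨u, hu⟩ := hS.preconnected.exists_adj_of_nontrivial v
  exact sum_pos' (fun _ _ => Nat.zero_le _) ⟨u, mem_univ u, hu⟩

theorem neg_degree_le_laplacian {f : V → ℝ} (h0 : ∀ v, 0 ≤ f v) (h1 : ∀ v, f v ≤ 1) (v : V) :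
    -(S.degree v : ℝ) ≤ S.laplacian f v := by
  rw [laplacian_apply, degree, Nat.cast_sum, ← sum_neg_distrib]
  refine sum_le_sum fun u _ => ?_
  have hmult : (0 : ℝ) ≤ S.mult v u := Nat.cast_nonneg _
  nlinarith [h0 v, h1 u, hmult]

theorem exists_laplacian_eq_one (hS : S.IsConnected) :
    ∃ h : V → ℝ, h S.sink = 0 ∧ (∀ v, 0 ≤ h v) ∧ ∀ v, v ≠ S.sink → S.laplacian h v = 1 := by
  classical
  obtain ⟨h, h0, h1⟩ := exists_laplacian_eq (Z := {S.sink}) hS rfl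
    (fun v => if v = S.sink then 0 else 1)
  have h0' : h S.sink = 0 := by simpa using h0 S.sink rfl
  have h1' : ∀ v, v ≠ S.sink → S.laplacian h v = 1 := fun v hv => by simpa [hv] using h1 v hv
  refine ⟨h, h0', nonneg_of_laplacian_nonneg (Z := {S.sink}) hS rfl ?_ ?_, h1'⟩
  · rintro _ rfl
    exact h0'.ge
  · exact fun v hv => zero_le_one.trans (h1' v hv).ge

theorem exists_le_laplacian_natCast (hS : S.IsConnected) (b : S.Site → ℝ) :
    ∃ y : V → ℕ, y S.sink = 0 ∧ ∀ u, b u ≤ S.laplacian (fun v => y v) u.1 := by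
  obtain ⟨h, h0, hnn, h1⟩ := exists_laplacian_eq_one hS
  obtain ⟨M, hM⟩ := (Set.finite_range fun u => b u + S.degree u.1).bddAbove
  obtain ⟨N, hN⟩ := exists_nat_ge M
  refine ⟨fun v => ⌈N * h v⌉₊, by simp [h0], fun u => ?_⟩
  have hround : S.laplacian (fun v => (⌈N * h v⌉₊ : ℝ)) u.1 =
      N + S.laplacian (fun v => ⌈N * h v⌉₊ - N * h v) u.1 := by
    have hsplit : (fun v => (⌈N * h v⌉₊ : ℝ)) =
        (N : ℝ) • h + fun v => ⌈N * h v⌉₊ - N * h v := by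
      ext v
      simp
    rw [hsplit, map_add, map_smul, Pi.add_apply, Pi.smul_apply, h1 u.1 u.2, smul_eq_mul, mul_one]
  have hlow := neg_degree_le_laplacian (S := S) (f := fun v => ⌈N * h v⌉₊ - N * h v)
    (fun v => sub_nonneg.2 (Nat.le_ceil _))
    (fun v => (sub_lt_iff_lt_add'.2 (Nat.ceil_lt_add_one
      (mul_nonneg (Nat.cast_nonneg _) (hnn v)))).le) u.1
  linarith [hM ⟨u, rfl⟩]

end Laplacian

section Potential

variable {V : Type*} [Fintype V] {S : SinkGraph V} {v w : V} {p q : V → ℝ}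

theorem isPotential_iff_laplacian :
    S.IsPotential w p ↔
      p S.sink = 0 ∧ p w = 1 ∧ ∀ v, v ≠ S.sink → v ≠ w → S.laplacian p v = 0 := by
  simp only [IsPotential, laplacian_eq_degree_mul_sub, sub_eq_zero, eq_comm (a := Finset.sum _ _)]

theorem IsPotential.laplacian_eq_zero (hp : S.IsPotential w p) (hv : v ≠ S.sink) (hvw : v ≠ w) :
    S.laplacian p v = 0 :=
  (isPotential_iff_laplacian.1 hp).2.2 v hv hvw

theorem IsPotential.ne_sink (hp : S.IsPotential w p) : w ≠ S.sink := by
  rintro rfl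
  exact zero_ne_one (hp.1.symm.trans hp.2.1)

theorem exists_isPotential (hS : S.IsConnected) (hw : w ≠ S.sink) : ∃ p, S.IsPotential w p := by
  classical
  obtain ⟨p, hp, hp'⟩ := exists_laplacian_eq (Z := {S.sink, w}) hS (by simp) (Pi.single w 1)
  refine ⟨p, isPotential_iff_laplacian.2 ⟨?_, ?_, fun v hv hvw => ?_⟩⟩
  · rw [hp _ (by simp), Pi.single_eq_of_ne hw.symm]
  · rw [hp _ (by simp), Pi.single_eq_same]
  · rw [hp' v (by simp [hv, hvw]), Pi.single_eq_of_ne hvw]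

theorem le_of_laplacian_le_of_ne (hS : S.IsConnected) {f g : V → ℝ} (hs : f S.sink ≤ g S.sink)
    (hw : f w ≤ g w)
    (hfg : ∀ v, v ≠ S.sink → v ≠ w → S.laplacian f v ≤ S.laplacian g v) (v : V) : f v ≤ g v := by
  refine le_of_laplacian_le (Z := {S.sink, w}) hS (Set.mem_insert _ _) ?_ (fun x hx => ?_) v
  · rintro x (rfl | rfl)
    exacts [hs, hw]
  · rw [Set.mem_insert_iff, Set.mem_singleton_iff, not_or] at hx
    exact hfg x hx.1 hx.2

theorem IsPotential.nonneg (hS : S.IsConnected) (hp : S.IsPotential w p) (v : V) : 0 ≤ p v :=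
  le_of_laplacian_le_of_ne hS (f := 0) (w := w) hp.1.ge (by simp [hp.2.1])
    (fun x hx hxw => by simp [hp.laplacian_eq_zero hx hxw]) v

theorem IsPotential.le_one (hS : S.IsConnected) (hp : S.IsPotential w p) (v : V) : p v ≤ 1 :=
  le_of_laplacian_le_of_ne hS (g := fun _ => 1) (w := w) (by simp [hp.1]) hp.2.1.le
    (fun x hx hxw => by simp [hp.laplacian_eq_zero hx hxw, laplacian_apply]) v

theorem IsPotential.unique (hS : S.IsConnected) (hp : S.IsPotential w p)
    (hq : S.IsPotential w q) : p = q := by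
  have hle : ∀ {p q : V → ℝ}, S.IsPotential w p → S.IsPotential w q → p ≤ q := fun hp hq =>
    le_of_laplacian_le_of_ne hS (hp.1.trans hq.1.symm).le (hp.2.1.trans hq.2.1.symm).le
      fun x hx hxw => by rw [hp.laplacian_eq_zero hx hxw, hq.laplacian_eq_zero hx hxw]
  exact le_antisymm (hle hp hq) (hle hq hp)

theorem IsPotential.laplacian_nonneg (hS : S.IsConnected) (hp : S.IsPotential w p)
    (hv : v ≠ S.sink) : 0 ≤ S.laplacian p v := by
  by_cases hvw : v = w
  · refine sum_nonneg fun u _ => mul_nonneg (Nat.cast_nonneg _) (sub_nonneg.2 ?_)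
    rw [hvw, hp.2.1]
    exact hp.le_one hS u
  · exact (hp.laplacian_eq_zero hv hvw).ge

theorem IsPotential.laplacian_le_degree (hS : S.IsConnected) (hp : S.IsPotential w p) :
    S.laplacian p w ≤ S.degree w := by
  rw [laplacian_eq_degree_mul_sub, hp.2.1, mul_one, sub_le_self_iff]
  exact sum_nonneg fun x _ => mul_nonneg (Nat.cast_nonneg _) (hp.nonneg hS x)

theorem IsPotential.le_degree_mul (hS : S.IsConnected) (hp : S.IsPotential w p)
    (hv : v ≠ S.sink) {u : V} (hvu : 0 < S.mult v u) : p u ≤ S.degree v * p v :=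
  calc p u ≤ S.mult v u * p u :=
        le_mul_of_one_le_left (hp.nonneg hS u) (Nat.one_le_cast.2 hvu)
    _ ≤ ∑ x, S.mult v x * p x :=
        single_le_sum (f := fun x => (S.mult v x : ℝ) * p x)
          (fun x _ => mul_nonneg (Nat.cast_nonneg _) (hp.nonneg hS x)) (mem_univ u)
    _ ≤ S.degree v * p v :=
        sub_nonneg.1 (S.laplacian_eq_degree_mul_sub p v ▸ hp.laplacian_nonneg hS hv)

/-- The Markov property: the walk from `v` may first go to `x`, and then from `x` to `w`. -/
theorem IsPotential.mul_le (hS : S.IsConnected) {x : V} (hp : S.IsPotential w p)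
    (hq : S.IsPotential x q) (v : V) : p x * q v ≤ p v :=
  le_of_laplacian_le_of_ne hS (f := p x • q) (w := x) (by simp [hp.1, hq.1]) (by simp [hq.2.1])
    (fun y hy hyx => by
      simpa [hq.laplacian_eq_zero hy hyx] using hp.laplacian_nonneg hS hy) v

theorem IsPotential.ge_of_boundary (hS : S.IsConnected) (hp : S.IsPotential w p) {ε : ℝ}
    (hε : ε ≤ 1) (hb : ∀ b, 0 < S.mult b S.sink → ε ≤ p b) (hv : v ≠ S.sink) : ε ≤ p v := by
  classical
  -- Subtracting `ε` off the sink does not change the Laplacian away from the boundary.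
  have h := nonneg_of_laplacian_nonneg (Z := {x | x = S.sink ∨ x = w ∨ 0 < S.mult x S.sink})
    (f := fun x => if x = S.sink then 0 else p x - ε) hS (Or.inl rfl) ?_ ?_ v
  · simpa [hv] using h
  · intro x hx
    split_ifs with hxs
    · exact le_rfl
    · rcases hx with hx | rfl | hx
      · exact absurd hx hxs
      · rw [hp.2.1]
        exact sub_nonneg.2 hε
      · exact sub_nonneg.2 (hb x hx)
  · intro x hx
    simp only [Set.mem_ofPred_eq, not_or, Nat.pos_iff_ne_zero, not_not] at hx
    rw [← hp.laplacian_eq_zero hx.1 hx.2.1]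
    refine (sum_congr rfl fun u _ => ?_).le
    by_cases hu : u = S.sink
    · simp [hu, hx.2.2]
    · simp [hu, hx.1]

theorem IsPotential.sum_mul_laplacian (hp : S.IsPotential w p) {f : V → ℝ} (hf : f S.sink = 0) :
    ∑ v, f v * S.laplacian p v = f w * S.laplacian p w := by
  refine sum_eq_single w (fun x _ hxw => ?_) (fun h => absurd (mem_univ w) h)
  by_cases hx : x = S.sink
  · rw [hx, hf, zero_mul]
  · rw [hp.laplacian_eq_zero hx hxw, mul_zero]

theorem IsPotential.reciprocity (hp : S.IsPotential w p) (hq : S.IsPotential v q) :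
    p v * S.laplacian q v = q w * S.laplacian p w := by
  rw [← hq.sum_mul_laplacian hp.1, sum_mul_laplacian_comm, hp.sum_mul_laplacian hq.1]

theorem IsPotential.energy_eq (hp : S.IsPotential w p) : S.energy p = S.laplacian p w := by
  rw [energy, hp.sum_mul_laplacian hp.1, hp.2.1, one_mul]

/-- `S.laplacian p w` is the effective conductance between `w` and the sink. -/
theorem IsPotential.one_le_card_sq_mul_laplacian (hS : S.IsConnected) (hp : S.IsPotential w p) :
    1 ≤ (Fintype.card V : ℝ) ^ 2 * S.laplacian p w := by
  obtain ⟨P, hP⟩ := hS.preconnected.exists_isPath w S.sink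
  have hE : 0 ≤ S.energy p := hp.energy_eq ▸ hp.laplacian_nonneg hS hp.ne_sink
  have hlen : (P.length : ℝ) ≤ Fintype.card V := by exact_mod_cast hP.length_lt.le
  have hpath : 1 ≤ (Fintype.card V : ℝ) * √(S.energy p) := by
    calc (1 : ℝ) = p w - p S.sink := by rw [hp.1, hp.2.1, sub_zero]
      _ ≤ P.length * √(S.energy p) := sub_le_length_mul_sqrt_energy p P
      _ ≤ Fintype.card V * √(S.energy p) := by gcongr
  calc (1 : ℝ) ≤ (Fintype.card V * √(S.energy p)) ^ 2 := one_le_pow₀ hpath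
    _ = Fintype.card V ^ 2 * S.laplacian p w := by rw [mul_pow, Real.sq_sqrt hE, hp.energy_eq]

/-- All potentials are at least `ε` on the sites. -/
def PotentialsGE (S : SinkGraph V) (ε : ℝ) : Prop :=
  ∀ ⦃w v : V⦄ ⦃p : V → ℝ⦄, v ≠ S.sink → S.IsPotential w p → ε ≤ p v

theorem PotentialsGE.mono {ε δ : ℝ} (h : S.PotentialsGE ε) (hδ : δ ≤ ε) : S.PotentialsGE δ :=
  fun _ _ _ hv hp => hδ.trans (h hv hp)

theorem potentialsGE_of_boundary (hS : S.IsConnected) {ε D : ℝ} (hε0 : 0 ≤ ε) (hε1 : ε ≤ 1)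
    (hD : 1 ≤ D) (hdeg : ∀ b, 0 < S.mult b S.sink → S.degree b ≤ D)
    (hb : ∀ b, 0 < S.mult b S.sink → ∃ p, S.IsPotential b p ∧
      ∀ b', 0 < S.mult b' S.sink → ε ≤ p b') :
    S.PotentialsGE (ε / (Fintype.card V ^ 2 * D)) := by
  intro w v p hv hp
  have hcard : 1 ≤ (Fintype.card V : ℝ) := by
    have : Nonempty V := ⟨w⟩
    exact_mod_cast Fintype.card_pos
  have hND : 1 ≤ Fintype.card V ^ 2 * D := one_le_mul_of_one_le_of_one_le (one_le_pow₀ hcard) hD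
  refine hp.ge_of_boundary hS ((div_le_self hε0 hND).trans hε1) (fun b hbs => ?_) hv
  obtain ⟨q, hq, hqb⟩ := hb b hbs
  have hqw : ε ≤ q w := hq.ge_of_boundary hS hε1 hqb hp.ne_sink
  have hlap : 0 ≤ S.laplacian p w := hp.laplacian_nonneg hS hp.ne_sink
  have hpb : 0 ≤ p b := hp.nonneg hS b
  rw [div_le_iff₀ (by positivity)]
  calc ε ≤ ε * (Fintype.card V ^ 2 * S.laplacian p w) :=
        le_mul_of_one_le_right hε0 (hp.one_le_card_sq_mul_laplacian hS)
    _ ≤ q w * (Fintype.card V ^ 2 * S.laplacian p w) := by gcongr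
    _ = Fintype.card V ^ 2 * (p b * S.laplacian q b) := by rw [hp.reciprocity hq]; ring
    _ ≤ Fintype.card V ^ 2 * (p b * D) := by
        gcongr
        exact (hq.laplacian_le_degree hS).trans (hdeg b hbs)
    _ = p b * (Fintype.card V ^ 2 * D) := by ring

end Potential

section Toppling

variable {V : Type*} [Fintype V] [DecidableEq V] {S : SinkGraph V}

/-- The pairing of a configuration with a function on the vertices. -/
def weight (S : SinkGraph V) (f : V → ℝ) (c : S.Config) : ℝ := ∑ v, (c v : ℝ) * f v.1

theorem weight_nonneg {f : V → ℝ} (hf : ∀ v, 0 ≤ f v) (c : S.Config) : 0 ≤ S.weight f c :=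
  sum_nonneg fun v _ => mul_nonneg (Nat.cast_nonneg _) (hf v)

theorem weight_zero (f : V → ℝ) : S.weight f 0 = 0 := by
  simp [weight]

theorem weight_add_single (f : V → ℝ) (c : S.Config) (v : S.Site) :
    S.weight f (c + Pi.single v 1) = S.weight f c + f v.1 := by
  simp [weight, add_mul, sum_add_distrib, Pi.single_apply]

theorem mul_le_weight {f : V → ℝ} (hf : ∀ v, 0 ≤ f v) (c : S.Config) (v : S.Site) :
    c v * f v.1 ≤ S.weight f c :=
  single_le_sum (f := fun v : S.Site => (c v : ℝ) * f v.1)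
    (fun v _ => mul_nonneg (Nat.cast_nonneg _) (hf v)) (mem_univ v)

theorem laplacian_single (v u : V) :
    S.laplacian (Pi.single v 1) u = if u = v then (S.degree v : ℝ) else -S.mult v u := by
  rw [laplacian_eq_degree_mul_sub]
  by_cases huv : u = v
  · simp [huv, Pi.single_apply, S.mult_self]
  · simp [huv, Pi.single_apply, S.mult_comm u v]

theorem cast_topple {c : S.Config} {v : S.Site} (h : S.Unstable c v) (u : S.Site) :
    (S.topple c v u : ℝ) = c u - S.laplacian (Pi.single v.1 1) u.1 := by
  by_cases huv : u = v
  · simp [topple, laplacian_single, huv, Nat.cast_sub h]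
  · simp [topple, laplacian_single, huv, Subtype.val_injective.ne huv]

theorem weight_topple {f : V → ℝ} (hf : f S.sink = 0) {c : S.Config} {v : S.Site}
    (h : S.Unstable c v) : S.weight f (S.topple c v) = S.weight f c - S.laplacian f v.1 := by
  have hsum : ∑ u : S.Site, S.laplacian (Pi.single v.1 1) u.1 * f u.1 = S.laplacian f v.1 := by
    calc ∑ u : S.Site, S.laplacian (Pi.single v.1 1) u.1 * f u.1
        = ∑ u, f u * S.laplacian (Pi.single v.1 1) u := by
          rw [Fintype.sum_eq_add_sum_subtype_ne _ S.sink, hf, zero_mul, zero_add]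
          simp only [mul_comm]
      _ = S.laplacian f v.1 := by
          rw [sum_mul_laplacian_comm]
          simp [Pi.single_apply]
  simp only [weight, cast_topple h, sub_mul, sum_sub_distrib, hsum]

theorem weight_le_of_topplesTo {f : V → ℝ} (h0 : f S.sink = 0)
    (hf : ∀ v, v ≠ S.sink → 0 ≤ S.laplacian f v) {c d : S.Config} (h : S.TopplesTo c d) :
    S.weight f d ≤ S.weight f c := by
  induction h with
  | refl => exact le_rfl
  | tail _ hstep ih =>
    obtain ⟨v, hv, rfl⟩ := hstep
    rw [weight_topple h0 hv]
    linarith [hf v.1 v.2]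

/-- Each toppling lowers the weight against the solution of `laplacian h = 1` by one. -/
theorem exists_stabilization (hS : S.IsConnected) (c : S.Config) :
    ∃ d, S.TopplesTo c d ∧ S.IsStable d := by
  obtain ⟨h, h0, hnn, h1⟩ := exists_laplacian_eq_one hS
  obtain ⟨n, hn⟩ := exists_nat_gt (S.weight h c)
  induction n generalizing c with
  | zero => exact absurd (weight_nonneg hnn c) (not_le.2 (by exact_mod_cast hn))
  | succ n ih =>
    by_cases hst : S.IsStable c
    · exact ⟨c, .refl, hst⟩
    · obtain ⟨v, hv⟩ : ∃ v, S.Unstable c v := by simpa [IsStable] using hst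
      have hlt : S.weight h (S.topple c v) < n := by
        rw [weight_topple h0 hv, h1 v.1 v.2, sub_lt_iff_lt_add]
        exact_mod_cast hn
      obtain ⟨d, hd, hd'⟩ := ih _ hlt
      exact ⟨d, .head ⟨v, hv, rfl⟩ hd, hd'⟩

end Toppling

section Recurrence

variable {V : Type*} {S : SinkGraph V}

/-- The number of edges from `u` to a set of sites. -/
def degreeIn (S : SinkGraph V) (A : Finset S.Site) (u : S.Site) : ℕ := ∑ x ∈ A, S.mult u.1 x.1

/-- Dhar's burning condition: no nonempty subset `A` of `T` supports a forbidden subconfiguration,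
that is, one with fewer than `degreeIn A u` particles at each `u ∈ A`. -/
def AllowedOn (S : SinkGraph V) (T : Finset S.Site) (c : S.Config) : Prop :=
  ∀ A ⊆ T, A.Nonempty → ∃ u ∈ A, S.degreeIn A u ≤ c u

theorem allowedOn_empty (c : S.Config) : S.AllowedOn ∅ c := fun _ hA hne =>
  absurd (subset_empty.1 hA) hne.ne_empty

theorem AllowedOn.mono {T : Finset S.Site} {c d : S.Config} (h : S.AllowedOn T c) (hcd : c ≤ d) :
    S.AllowedOn T d := fun A hA hne =>
  let ⟨u, hu, hle⟩ := h A hA hne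
  ⟨u, hu, hle.trans (hcd u)⟩

variable [Fintype V]

theorem degreeIn_le_degree (A : Finset S.Site) (u : S.Site) : S.degreeIn A u ≤ S.degree u.1 := by
  classical
  calc S.degreeIn A u ≤ ∑ x : S.Site, S.mult u.1 x.1 := sum_le_sum_of_subset (subset_univ A)
    _ ≤ S.degree u.1 := by
      rw [degree, Fintype.sum_eq_add_sum_subtype_ne _ S.sink]
      exact Nat.le_add_left _ _

variable [DecidableEq V]

theorem AllowedOn.topple {T : Finset S.Site} {c : S.Config} (h : S.AllowedOn T c) (v : S.Site) :
    S.AllowedOn (insert v T) (S.topple c v) := by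
  intro A hA hne
  rw [subset_insert_iff] at hA
  rcases (A.erase v).eq_empty_or_nonempty with he | he
  · have hAv : A = {v} := (erase_eq_empty_iff A v).1 he |>.resolve_left hne.ne_empty
    exact ⟨v, hAv ▸ mem_singleton_self v, by simp [hAv, degreeIn, S.mult_self]⟩
  · obtain ⟨u, hu, hle⟩ := h _ hA he
    refine ⟨u, mem_of_mem_erase hu, ?_⟩
    calc S.degreeIn A u ≤ S.degreeIn (insert v (A.erase v)) u :=
          sum_le_sum_of_subset (insert_erase_subset v A)
      _ = S.degreeIn (A.erase v) u + S.mult v.1 u.1 := by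
          rw [degreeIn, sum_insert (notMem_erase v A), S.mult_comm, add_comm, degreeIn]
      _ ≤ c u + S.mult v.1 u.1 := Nat.add_le_add_right hle _
      _ = S.topple c v u := by simp only [SinkGraph.topple, if_neg (ne_of_mem_erase hu)]

theorem degree_le_degreeIn_add_laplacian {y : V → ℕ} {u : S.Site} (hmax : ∀ v, y v ≤ y u.1)
    (hs : y S.sink < y u.1) :
    (S.degree u.1 : ℝ) ≤
      S.degreeIn (univ.filter fun z => y z.1 = y u.1) u + S.laplacian (fun v => y v) u.1 := by
  have hin : S.degreeIn (univ.filter fun z => y z.1 = y u.1) u =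
      ∑ v, if y v = y u.1 then S.mult u.1 v else 0 := by
    rw [degreeIn, sum_filter, Fintype.sum_eq_add_sum_subtype_ne _ S.sink, if_neg hs.ne, zero_add]
  rw [hin, degree, laplacian_apply]
  push_cast
  rw [← sum_add_distrib]
  refine sum_le_sum fun v _ => ?_
  by_cases hv : y v = y u.1
  · simp [hv]
  · have hlt : (y v : ℝ) + 1 ≤ y u.1 := by exact_mod_cast lt_of_le_of_ne (hmax v) hv
    rw [if_neg hv, zero_add]
    exact le_mul_of_one_le_right (Nat.cast_nonneg _) (by linarith)

/-- Where the number `y` of pending topplings is maximal, some site is unstable because the target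
configuration `c` is allowed there. -/
theorem AllowedOn.exists_unstable {c c' : S.Config} (hc : S.AllowedOn univ c) {y : V → ℕ}
    (hc' : ∀ u : S.Site, (c' u : ℝ) = c u + S.laplacian (fun v => y v) u.1) {v : V}
    (hv : y S.sink < y v) : ∃ u : S.Site, 0 < y u.1 ∧ S.Unstable c' u := by
  have : Nonempty V := ⟨S.sink⟩
  obtain ⟨x, hx⟩ := Finite.exists_max y
  have hx0 : y S.sink < y x := hv.trans_le (hx v)
  obtain ⟨u, huA, hu⟩ := hc (univ.filter fun z => y z.1 = y x) (subset_univ _)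
    ⟨⟨x, fun h => hx0.ne (congrArg y h.symm)⟩, by simp⟩
  have hyu : y u.1 = y x := by simpa using huA
  refine ⟨u, hyu ▸ Nat.zero_lt_of_lt hx0, ?_⟩
  have hdeg := degree_le_degreeIn_add_laplacian (u := u) (hyu ▸ hx) (hyu ▸ hx0)
  have hu' : (S.degreeIn (univ.filter fun z => y z.1 = y x) u : ℝ) ≤ c u := by
    exact_mod_cast hu
  rw [hyu] at hdeg
  exact_mod_cast hdeg.trans ((add_le_add_left hu' _).trans (hc' u).ge)

theorem topplesTo_of_allowedOn {c c' : S.Config} (hc : S.AllowedOn univ c) {y : V → ℕ}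
    (hy : y S.sink = 0) (hc' : ∀ u : S.Site, (c' u : ℝ) = c u + S.laplacian (fun v => y v) u.1) :
    S.TopplesTo c' c := by
  induction hn : ∑ v, y v generalizing y c' with
  | zero =>
    have hy0 : y = 0 := funext fun v => sum_eq_zero_iff.1 hn v (mem_univ v)
    have hcc' : c' = c := funext fun u => by simpa [hy0, laplacian_apply] using hc' u
    rw [hcc']
    exact .refl
  | succ n ih =>
    obtain ⟨v, -, hv⟩ : ∃ v ∈ univ, y v ≠ 0 := exists_ne_zero_of_sum_ne_zero (by omega)
    obtain ⟨u, hyu, hu⟩ := hc.exists_unstable hc' (v := v) (by omega)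
    obtain ⟨z, rfl⟩ : ∃ z, y = z + Pi.single u.1 1 := by
      refine ⟨y - Pi.single u.1 1, (tsub_add_cancel_of_le fun v => ?_).symm⟩
      rcases eq_or_ne v u.1 with rfl | hv
      · rwa [Pi.single_eq_same]
      · simp [hv]
    have hcast : (fun v => ((z + Pi.single u.1 1 : V → ℕ) v : ℝ)) =
        (fun v => (z v : ℝ)) + Pi.single u.1 1 := by
      ext v
      simp [Pi.single_apply]
    refine .head ⟨u, hu, rfl⟩ (ih (y := z) (by simp_all) (fun w => ?_) ?_)
    · rw [cast_topple hu, hc', hcast, map_add, Pi.add_apply]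
      ring
    · simpa [sum_add_distrib] using hn

theorem AllowedOn.isRecurrent (hS : S.IsConnected) {c : S.Config} (hc : S.AllowedOn univ c) :
    S.IsRecurrent c := by
  intro c'
  obtain ⟨y, hy, hle⟩ := exists_le_laplacian_natCast hS fun u => (c' u : ℝ)
  let drop (u : S.Site) : ℤ := ∑ v, (S.mult u.1 v : ℤ) * (y u.1 - y v)
  have hdrop : ∀ u, (drop u : ℝ) = S.laplacian (fun v => y v) u.1 := fun u => by
    simp [drop, laplacian_apply]
  have hle' : ∀ u, (c' u : ℤ) ≤ drop u := fun u => by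
    have h := hle u
    rw [← hdrop] at h
    exact_mod_cast h
  have hdrop0 : ∀ u, 0 ≤ drop u := fun u => (Nat.cast_nonneg _).trans (hle' u)
  refine ⟨fun u => c u + (drop u).toNat, fun u => ?_, topplesTo_of_allowedOn hc hy fun u => ?_⟩
  · have := hle' u
    dsimp only
    omega
  · rw [← hdrop, Nat.cast_add, add_right_inj]
    exact_mod_cast Int.toNat_of_nonneg (hdrop0 u)

theorem IsRecurrent.allowedOn_univ {c : S.Config} (hc : S.IsRecurrent c) :
    S.AllowedOn univ c := by
  obtain ⟨c', hle, hT⟩ := hc fun u => S.degree u.1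
  clear hc
  induction hT with
  | refl => exact fun A _ ⟨u, hu⟩ => ⟨u, hu, (S.degreeIn_le_degree A u).trans (hle u)⟩
  | tail _ hstep ih =>
    obtain ⟨v, -, rfl⟩ := hstep
    simpa using ih.topple v

theorem IsRecurrent.pos_or_pos {c : S.Config} (hc : S.IsRecurrent c) {a b : S.Site}
    (hab : 0 < S.mult a.1 b.1) : 0 < c a ∨ 0 < c b := by
  have hne : a ≠ b := by
    rintro rfl
    exact hab.ne' (S.mult_self _)
  obtain ⟨u, hu, hle⟩ := hc.allowedOn_univ {a, b} (subset_univ _) ⟨a, mem_insert_self a _⟩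
  rw [degreeIn, sum_pair hne] at hle
  rcases mem_insert.1 hu with rfl | hu
  · exact .inl (by omega)
  · obtain rfl := mem_singleton.1 hu
    rw [S.mult_comm] at hab
    exact .inr (by omega)

end Recurrence

/-! ### The transience class and the potentials -/

section Transience

variable {V : Type*} {S : SinkGraph V}

theorem exists_site_adj (hO : (S.adjGraph.induce {v | v ≠ S.sink}).Preconnected)
    [Nontrivial S.Site] (a : S.Site) : ∃ b : S.Site, 0 < S.mult a.1 b.1 :=
  have : Nontrivial {v | v ≠ S.sink} := ‹Nontrivial S.Site›
  hO.exists_adj_of_nontrivial a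

variable [Fintype V] [DecidableEq V]

theorem le_tcl {k : ℕ} {c : S.Config} (h : S.TransientRun k c) : (k : ℕ∞) ≤ S.tcl :=
  le_iSup₂ (f := fun (k : ℕ) (_ : k ∈ {k : ℕ | ∃ c, S.TransientRun k c}) => (k : ℕ∞)) k ⟨c, h⟩

theorem tcl_le {N : ℕ} (h : ∀ k c, S.TransientRun k c → k ≤ N) : S.tcl ≤ (N : ℕ∞) :=
  iSup₂_le fun k ⟨c, hc⟩ => by exact_mod_cast h k c hc

theorem TransientRun.not_isRecurrent {k : ℕ} {c : S.Config} (h : S.TransientRun k c) :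
    ¬ S.IsRecurrent c := by
  cases h <;> assumption

theorem TransientRun.isStable (hS : S.IsConnected) {k : ℕ} {c : S.Config}
    (h : S.TransientRun k c) : S.IsStable c := by
  cases h with
  | empty => exact fun v => not_le.2 (degree_pos hS v.2)
  | add => assumption

theorem TopplesTo.exists_allowedOn {c d : S.Config} (h : S.TopplesTo c d) {T : Finset S.Site}
    (hT : S.AllowedOn T c) :
    ∃ T', T ⊆ T' ∧ S.AllowedOn T' d ∧
      ∀ w : S.Site, w ∉ T' → ∀ p, S.IsPotential w.1 p → S.weight p d = S.weight p c := by
  induction h with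
  | refl => exact ⟨T, Subset.rfl, hT, fun _ _ _ _ => rfl⟩
  | tail _ hstep ih =>
    obtain ⟨T', hTT', hT', hw⟩ := ih
    obtain ⟨x, hx, rfl⟩ := hstep
    refine ⟨insert x T', hTT'.trans (subset_insert x T'), hT'.topple x, fun w hwT p hp => ?_⟩
    rw [mem_insert, not_or] at hwT
    rw [weight_topple hp.1 hx, hp.laplacian_eq_zero x.2 fun h => hwT.1 (Subtype.ext h.symm),
      sub_zero, hw w hwT.2 p hp]

/-- `T` is the set of sites that have toppled: the topplings preserve the weight against a
potential at any other site, and every added particle contributes at least `ε`. -/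
theorem TransientRun.exists_allowedOn {ε : ℝ} (hε : S.PotentialsGE ε) {k : ℕ} {c : S.Config}
    (h : S.TransientRun k c) :
    ∃ T, S.AllowedOn T c ∧
      ∀ w : S.Site, w ∉ T → ∀ p, S.IsPotential w.1 p → k * ε ≤ S.weight p c := by
  induction h with
  | empty => exact ⟨∅, allowedOn_empty _, fun w _ p _ => by simp [weight_zero]⟩
  | @add k c d v _ htop _ _ ih =>
    obtain ⟨T, hT, hw⟩ := ih
    obtain ⟨T', hTT', hT', hw'⟩ := htop.exists_allowedOn
      (hT.mono (le_add_of_nonneg_right fun _ => Nat.zero_le _))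
    refine ⟨T', hT', fun w hwT p hp => ?_⟩
    rw [hw' w hwT p hp, weight_add_single, Nat.cast_succ, add_one_mul]
    exact add_le_add (hw w (fun h => hwT (hTT' h)) p hp) (hε v.2 hp)

theorem TransientRun.mul_le_sum_degree (hS : S.IsConnected) {ε : ℝ} (hε : S.PotentialsGE ε)
    {k : ℕ} {c : S.Config} (h : S.TransientRun k c) :
    k * ε ≤ ∑ v : S.Site, (S.degree v.1 : ℝ) := by
  obtain ⟨T, hT, hw⟩ := h.exists_allowedOn hε
  obtain ⟨w, hwT⟩ : ∃ w, w ∉ T := by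
    by_contra! hall
    exact h.not_isRecurrent (AllowedOn.isRecurrent hS (eq_univ_of_forall hall ▸ hT))
  obtain ⟨p, hp⟩ := exists_isPotential hS w.2
  refine (hw w hwT p hp).trans (sum_le_sum fun v _ => ?_)
  have hc : (c v : ℝ) ≤ S.degree v.1 := by exact_mod_cast (not_le.1 (h.isStable hS v)).le
  exact (mul_le_of_le_one_right (Nat.cast_nonneg _) (hp.le_one hS v.1)).trans hc

theorem tcl_le_of_potentialsGE (hS : S.IsConnected) {M : ℕ} (hM : 0 < M)
    (hε : S.PotentialsGE (M : ℝ)⁻¹) :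
    S.tcl ≤ ((M * ∑ v : S.Site, S.degree v.1 : ℕ) : ℕ∞) := by
  refine tcl_le fun k c h => ?_
  have hk := h.mul_le_sum_degree hS hε
  rw [mul_inv_le_iff₀ (by positivity), mul_comm] at hk
  exact_mod_cast hk

theorem exists_transientRun_or_isRecurrent (hS : S.IsConnected) {f : V → ℝ}
    (h0 : f S.sink = 0) (hf : ∀ v, v ≠ S.sink → 0 ≤ S.laplacian f v) (hnn : ∀ v, 0 ≤ f v)
    (v : S.Site) (k : ℕ) :
    ∃ c, (S.TransientRun k c ∨ S.IsRecurrent c) ∧ S.weight f c ≤ k * f v.1 := by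
  induction k with
  | zero =>
    refine ⟨0, ?_, by simp [weight_zero]⟩
    by_cases h : S.IsRecurrent 0
    exacts [.inr h, .inl (.empty h)]
  | succ k ih =>
    obtain ⟨c, hc | hc, hle⟩ := ih
    · obtain ⟨d, hd, hst⟩ := exists_stabilization hS (c + Pi.single v 1)
      refine ⟨d, ?_, ?_⟩
      · by_cases hrec : S.IsRecurrent d
        exacts [.inr hrec, .inl (.add v hc hd hst hrec)]
      · calc S.weight f d ≤ S.weight f (c + Pi.single v 1) := weight_le_of_topplesTo h0 hf hd
          _ = S.weight f c + f v.1 := weight_add_single f c v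
          _ ≤ (k + 1 : ℕ) * f v.1 := by push_cast; linarith
    · refine ⟨c, .inr hc, hle.trans ?_⟩
      exact mul_le_mul_of_nonneg_right (Nat.cast_le.2 k.le_succ) (hnn v.1)

theorem exists_isRecurrent_weight_le (hS : S.IsConnected) {K : ℕ} (hK : S.tcl ≤ (K : ℕ∞))
    {f : V → ℝ} (h0 : f S.sink = 0) (hf : ∀ v, v ≠ S.sink → 0 ≤ S.laplacian f v)
    (hnn : ∀ v, 0 ≤ f v) (v : S.Site) :
    ∃ c, S.IsRecurrent c ∧ S.weight f c ≤ (K + 1 : ℕ) * f v.1 := by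
  obtain ⟨c, hc | hc, hle⟩ := exists_transientRun_or_isRecurrent hS h0 hf hnn v (K + 1)
  · exact absurd (Nat.cast_le.1 ((le_tcl hc).trans hK)) K.not_succ_le_self
  · exact ⟨c, hc, hle⟩

theorem IsRecurrent.one_le_mul_weight (hS : S.IsConnected) {c : S.Config} (hc : S.IsRecurrent c)
    {D : ℕ} (hD : ∀ v, v ≠ S.sink → S.degree v ≤ D) {w : V} {p : V → ℝ} (hp : S.IsPotential w p)
    {x : S.Site} (hwx : 0 < S.mult w x.1) : 1 ≤ D * S.weight p c := by
  have hnn := hp.nonneg hS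
  suffices hsite : ∃ y : S.Site, 0 < c y ∧ 1 ≤ (D : ℝ) * p y.1 by
    obtain ⟨y, hcy, hpy⟩ := hsite
    calc (1 : ℝ) ≤ D * p y.1 := hpy
      _ ≤ D * (c y * p y.1) := by
        gcongr
        exact le_mul_of_one_le_left (hnn _) (Nat.one_le_cast.2 hcy)
      _ ≤ D * S.weight p c := by
        gcongr
        exact mul_le_weight hnn c y
  have hdeg : ∀ y : S.Site, (S.degree y.1 : ℝ) ≤ D := fun y => by exact_mod_cast hD y.1 y.2
  rcases hc.pos_or_pos (a := ⟨w, hp.ne_sink⟩) hwx with hcw | hcx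
  · refine ⟨_, hcw, ?_⟩
    rw [hp.2.1, mul_one]
    exact_mod_cast (degree_pos hS hp.ne_sink).trans_le (hD w hp.ne_sink)
  · refine ⟨x, hcx, ?_⟩
    have hstep := hp.le_degree_mul hS x.2 (S.mult_comm w x.1 ▸ hwx)
    rw [hp.2.1] at hstep
    exact hstep.trans (mul_le_mul_of_nonneg_right (hdeg x) (hnn _))

theorem potentialsGE_of_tcl_le (hS : S.IsConnected)
    (hO : (S.adjGraph.induce {v | v ≠ S.sink}).Preconnected) {K D : ℕ}
    (hK : S.tcl ≤ (K : ℕ∞)) (hD : ∀ v, v ≠ S.sink → S.degree v ≤ D) :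
    S.PotentialsGE ((D * (K + 1) : ℕ) : ℝ)⁻¹ := by
  intro w v p hv hp
  by_cases hvw : v = w
  · rw [hvw, hp.2.1]
    exact Nat.cast_inv_le_one _
  have : Nontrivial S.Site := ⟨⟨v, hv⟩, ⟨w, hp.ne_sink⟩, fun h => hvw (congrArg Subtype.val h)⟩
  obtain ⟨x, hwx⟩ := exists_site_adj hO ⟨w, hp.ne_sink⟩
  obtain ⟨c, hc, hle⟩ := exists_isRecurrent_weight_le hS hK hp.1
    (fun x hx => hp.laplacian_nonneg hS hx) (hp.nonneg hS) ⟨v, hv⟩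
  have hD0 : 0 < D := (degree_pos hS hv).trans_le (hD v hv)
  rw [inv_le_iff_one_le_mul₀' (by positivity)]
  calc (1 : ℝ) ≤ D * S.weight p c := hc.one_le_mul_weight hS hD hp hwx
    _ ≤ D * ((K + 1 : ℕ) * p v) := by gcongr
    _ = (D * (K + 1) : ℕ) * p v := by push_cast; ring

theorem transientRun_indicator (hdeg : ∀ v : S.Site, 2 ≤ S.degree v.1) {a b : S.Site}
    (hab : 0 < S.mult a.1 b.1) {A : Finset S.Site} (ha : a ∉ A) (hb : b ∉ A) :
    S.TransientRun A.card (fun v => if v ∈ A then 1 else 0) := by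
  have hrec : ∀ {A : Finset S.Site}, a ∉ A → b ∉ A →
      ¬ S.IsRecurrent (fun v => if v ∈ A then 1 else 0) := fun ha hb h => by
    simpa [ha, hb] using h.pos_or_pos hab
  induction A using Finset.induction_on with
  | empty => exact .empty (hrec ha hb)
  | insert x A hxA ih =>
    rw [card_insert_of_notMem hxA]
    refine .add x (ih (fun h => ha (mem_insert_of_mem h)) fun h => hb (mem_insert_of_mem h))
      (d := fun v => if v ∈ insert x A then 1 else 0) ?_ (fun v hv => ?_) (hrec ha hb)
    · have hadd : ((fun v => if v ∈ A then 1 else 0) + Pi.single x 1 : S.Config) =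
          fun v => if v ∈ insert x A then 1 else 0 := by
        funext v
        rcases eq_or_ne v x with rfl | hvx
        · simp [hxA]
        · simp [hvx]
      exact hadd ▸ .refl
    · have hv2 : 2 ≤ if v ∈ insert x A then 1 else 0 := (hdeg v).trans hv
      split_ifs at hv2 <;> omega

theorem card_site_le (hO : (S.adjGraph.induce {v | v ≠ S.sink}).Preconnected)
    (hdeg : ∀ v : S.Site, 2 ≤ S.degree v.1) {K : ℕ} (hK : S.tcl ≤ (K : ℕ∞)) :
    Fintype.card S.Site ≤ K + 2 := by
  rcases subsingleton_or_nontrivial S.Site with hsub | hnt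
  · have := Fintype.card_le_one_iff_subsingleton.2 hsub
    omega
  obtain ⟨a⟩ := hnt.to_nonempty
  obtain ⟨b, hab⟩ := exists_site_adj hO a
  have hrun := transientRun_indicator hdeg hab (A := {a, b}ᶜ) (by simp) (by simp)
  have hcard : ({a, b}ᶜ : Finset S.Site).card ≤ K := by
    exact_mod_cast (le_tcl hrun).trans hK
  rw [card_compl] at hcard
  have := card_le_two (a := a) (b := b)
  omega

end Transience

/-! ### Changing the edges at the sink -/

section SinkConductance

variable {V : Type*}

/-- The two sandpiles have the same sink, and they differ only in the edges at the sink. -/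
structure AgreeOffSink (S T : SinkGraph V) : Prop where
  sink_eq : T.sink = S.sink
  mult_eq : ∀ ⦃u v⦄, u ≠ S.sink → v ≠ S.sink → T.mult u v = S.mult u v

variable [Fintype V] {S T : SinkGraph V} {v w : V} {f p q : V → ℝ}

theorem AgreeOffSink.laplacian_eq (h : S.AgreeOffSink T) (hf : f S.sink = 0) (hv : v ≠ S.sink) :
    T.laplacian f v =
      S.laplacian f v + ((T.mult v T.sink : ℝ) - S.mult v S.sink) * f v := by
  classical
  have hsites : ∑ u : S.Site, (T.mult v u : ℝ) * (f v - f u) =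
      ∑ u : S.Site, (S.mult v u : ℝ) * (f v - f u) :=
    sum_congr rfl fun u _ => by rw [h.mult_eq hv u.2]
  rw [laplacian_apply, laplacian_apply, Fintype.sum_eq_add_sum_subtype_ne _ S.sink,
    Fintype.sum_eq_add_sum_subtype_ne (fun u => (S.mult v u : ℝ) * _) S.sink, hsites, hf, h.sink_eq]
  ring

/-- Convexity of the power, as a pointwise estimate; at the sink the tangent line is `0`, so the
edges to the sink are gained `k` more times. -/
theorem laplacian_pow_le (h0 : f S.sink = 0) (hf : ∀ v, 0 ≤ f v) (k : ℕ) (v : V) :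
    S.laplacian (fun u => f u ^ (k + 1)) v + k * S.mult v S.sink * f v ^ (k + 1) ≤
      (k + 1) * f v ^ k * S.laplacian f v := by
  classical
  have hsites : ∑ u : S.Site, (S.mult v u : ℝ) * (f v ^ (k + 1) - f u ^ (k + 1)) ≤
      (k + 1) * f v ^ k * ∑ u : S.Site, (S.mult v u : ℝ) * (f v - f u) := by
    rw [mul_sum]
    refine sum_le_sum fun u _ => ?_
    have htangent := pow_add_mul_le_add_pow (b := f u - f v) (hf v)
      (by linarith [hf v, hf u]) (k + 1)
    rw [add_sub_cancel, Nat.add_sub_cancel, Nat.cast_succ] at htangent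
    rw [mul_left_comm]
    exact mul_le_mul_of_nonneg_left (by linarith) (Nat.cast_nonneg _)
  rw [laplacian_apply, laplacian_apply, Fintype.sum_eq_add_sum_subtype_ne _ S.sink,
    Fintype.sum_eq_add_sum_subtype_ne (fun u => (S.mult v u : ℝ) * (f v - f u)) S.sink, h0,
    zero_pow k.succ_ne_zero]
  linear_combination hsites

theorem IsPotential.le_of_sink_mult_le (hS : S.IsConnected) (hT : T.IsConnected)
    (h : S.AgreeOffSink T) (hle : ∀ v, S.mult v S.sink ≤ T.mult v T.sink)
    (hp : S.IsPotential w p) (hq : T.IsPotential w q) (v : V) : q v ≤ p v := by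
  have hq0 : q S.sink = 0 := h.sink_eq ▸ hq.1
  refine le_of_laplacian_le_of_ne hS (hq0.trans hp.1.symm).le (hq.2.1.trans hp.2.1.symm).le
    (fun x hx hxw => ?_) v
  have hlap := h.laplacian_eq hq0 hx
  rw [hq.laplacian_eq_zero (h.sink_eq ▸ hx) hxw] at hlap
  have hgain : 0 ≤ ((T.mult x T.sink : ℝ) - S.mult x S.sink) * q x :=
    mul_nonneg (sub_nonneg.2 (Nat.cast_le.2 (hle x))) (hq.nonneg hT x)
  rw [hp.laplacian_eq_zero hx hxw]
  linarith

theorem IsPotential.pow_le_of_sink_mult_le (hS : S.IsConnected) (hT : T.IsConnected)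
    (h : S.AgreeOffSink T) {k : ℕ} (hk : k ≠ 0)
    (hle : ∀ v, T.mult v T.sink ≤ k * S.mult v S.sink)
    (hp : S.IsPotential w p) (hq : T.IsPotential w q) (v : V) : p v ^ k ≤ q v := by
  obtain ⟨k, rfl⟩ := Nat.exists_eq_add_one_of_ne_zero hk
  have hpow0 : p S.sink ^ (k + 1) = 0 := by rw [hp.1, zero_pow k.succ_ne_zero]
  refine le_of_laplacian_le_of_ne (f := fun x => p x ^ (k + 1)) hT
    (by rw [h.sink_eq, hpow0, ← h.sink_eq, hq.1]) (by rw [hp.2.1, hq.2.1, one_pow])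
    (fun x hx hxw => ?_) v
  rw [hq.laplacian_eq_zero hx hxw]
  rw [h.sink_eq] at hx
  rw [h.laplacian_eq hpow0 hx]
  have hconv := laplacian_pow_le hp.1 (hp.nonneg hS) k x
  rw [hp.laplacian_eq_zero hx hxw, mul_zero] at hconv
  have hmult : (T.mult x T.sink : ℝ) ≤ (k + 1) * S.mult x S.sink := by exact_mod_cast hle x
  have hgain := mul_le_mul_of_nonneg_right hmult (pow_nonneg (hp.nonneg hS x) (k + 1))
  linarith

end SinkConductance

/-! ### Network equivalent families -/

section Family

/-- `g` is bounded by a polynomial in the index, for all large indices. -/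
def IsPolyBounded (g : ℕ → ℕ∞) : Prop :=
  ∃ k C : ℕ, ∀ᶠ n in Filter.atTop, g n ≤ ((C * n ^ k : ℕ) : ℕ∞)

theorem IsPolyBounded.sup {f g : ℕ → ℕ∞} (hf : IsPolyBounded f) (hg : IsPolyBounded g) :
    IsPolyBounded (f ⊔ g) := by
  obtain ⟨k, C, hf⟩ := hf
  obtain ⟨l, D, hg⟩ := hg
  refine ⟨k + l, C + D, ?_⟩
  filter_upwards [hf, hg, Filter.eventually_ge_atTop 1] with n hfn hgn hn
  refine sup_le (hfn.trans (Nat.cast_le.2 ?_)) (hgn.trans (Nat.cast_le.2 ?_))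
  · exact Nat.mul_le_mul (C.le_add_right D) (Nat.pow_le_pow_right hn (k.le_add_right l))
  · exact Nat.mul_le_mul (D.le_add_left C) (Nat.pow_le_pow_right hn (l.le_add_left k))

theorem IsPolyBounded.of_forall_le {f g : ℕ → ℕ∞} (hf : IsPolyBounded f) (A m : ℕ)
    (h : ∀ n K : ℕ, f n ≤ K → g n ≤ ((A * (K + 1) ^ m : ℕ) : ℕ∞)) : IsPolyBounded g := by
  obtain ⟨k, C, hf⟩ := hf
  refine ⟨k * m, A * (C + 1) ^ m, ?_⟩
  filter_upwards [hf, Filter.eventually_ge_atTop 1] with n hfn hn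
  refine (h n _ hfn).trans (Nat.cast_le.2 ?_)
  calc A * (C * n ^ k + 1) ^ m ≤ A * (C * n ^ k + n ^ k) ^ m := by
        gcongr
        exact Nat.one_le_pow _ _ hn
    _ = A * (C + 1) ^ m * n ^ (k * m) := by
        rw [pow_mul, mul_assoc, ← mul_pow, add_one_mul]

theorem PolySize.isPolyBounded {V : ℕ → Type*} [∀ n, Fintype (V n)] {S : ∀ n, SinkGraph (V n)}
    (h : PolySize S) : IsPolyBounded fun n => (S n).numEdges := by
  obtain ⟨k, C, h⟩ := h
  exact ⟨k, C, h.mono fun n hn => Nat.cast_le.2 hn⟩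

end Family

section NetworkEquiv

variable {V W : Type*}

theorem ne_sink_of_mult_sink_pos {S : SinkGraph V} {v : V} (h : 0 < S.mult v S.sink) :
    v ≠ S.sink := by
  rintro rfl
  exact h.ne' (S.mult_self _)

variable [Fintype V] [Fintype W] {S : SinkGraph V} {T : SinkGraph W}

theorem NetworkEquiv.symm (h : S.NetworkEquiv T) : T.NetworkEquiv S := by
  obtain ⟨e, he⟩ := h
  refine ⟨e.symm, fun v => ?_⟩
  obtain ⟨p, q, hp, hq, hpq⟩ := he (e.symm v)
  rw [e.apply_symm_apply] at hq
  refine ⟨q, p, hq, hp, fun w => ?_⟩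
  rw [hpq, e.apply_symm_apply]

-- The summand `1` makes up for the truncated division in `numEdges`.
theorem sum_degree_le (S : SinkGraph V) : ∑ v, S.degree v ≤ 2 * S.numEdges + 1 := by
  rw [numEdges]
  omega

theorem degree_le (S : SinkGraph V) (v : V) : S.degree v ≤ 2 * S.numEdges + 1 :=
  (single_le_sum (f := S.degree) (fun _ _ => Nat.zero_le _) (mem_univ v)).trans S.sum_degree_le

theorem card_le (hS : S.IsConnected) : Fintype.card V ≤ 2 * S.numEdges + 1 := by
  rcases subsingleton_or_nontrivial V with hsub | hnt
  · exact (Fintype.card_le_one_iff_subsingleton.2 hsub).trans (Nat.le_add_left 1 _)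
  · refine le_trans ?_ S.sum_degree_le
    rw [← card_univ, card_eq_sum_ones]
    refine sum_le_sum fun v _ => ?_
    obtain ⟨u, hu⟩ := exists_ne v
    exact degree_pos hS hu.symm

theorem NetworkEquiv.potentialsGE (h : S.NetworkEquiv T) (hT : T.IsConnected) {ε D : ℝ}
    (hε : S.PotentialsGE ε) (hε0 : 0 ≤ ε) (hε1 : ε ≤ 1) (hD : 1 ≤ D)
    (hdeg : ∀ b, 0 < T.mult b T.sink → T.degree b ≤ D) :
    T.PotentialsGE (ε / (Fintype.card W ^ 2 * D)) := by
  obtain ⟨e, he⟩ := h.symm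
  refine potentialsGE_of_boundary hT hε0 hε1 hD hdeg fun b hb => ?_
  obtain ⟨p, q, hp, hq, hpq⟩ := he ⟨b, hb⟩
  refine ⟨p, hp, fun b' hb' => ?_⟩
  rw [hpq ⟨b', hb'⟩]
  exact hε (ne_sink_of_mult_sink_pos (e ⟨b', hb'⟩).2) hq

variable [DecidableEq V] [DecidableEq W]

theorem NetworkEquiv.tcl_le (h : S.NetworkEquiv T) (hS : S.IsConnected)
    (hSO : (S.adjGraph.induce {v | v ≠ S.sink}).Preconnected) (hT : T.IsConnected) {K : ℕ}
    (hK : S.tcl ≤ (K : ℕ∞)) (hSK : S.numEdges ≤ K) (hTK : T.numEdges ≤ K) :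
    T.tcl ≤ ((32 * (K + 1) ^ 6 : ℕ) : ℕ∞) := by
  set D := 2 * K + 1 with hD
  have hcard : Fintype.card W ≤ D := (card_le hT).trans (by omega)
  have hS_ge : S.PotentialsGE ((D * (K + 1) : ℕ) : ℝ)⁻¹ :=
    potentialsGE_of_tcl_le hS hSO hK fun v _ => (S.degree_le v).trans (by omega)
  have hT_ge : T.PotentialsGE ((D ^ 4 * (K + 1) : ℕ) : ℝ)⁻¹ := by
    have : Nonempty W := ⟨T.sink⟩
    refine (h.potentialsGE hT hS_ge (by positivity) (Nat.cast_inv_le_one _) (D := ((D : ℕ) : ℝ))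
      (by simp [hD]) fun b _ => Nat.cast_le.2 ((T.degree_le b).trans (by omega))).mono ?_
    rw [div_eq_mul_inv, ← mul_inv]
    gcongr
    calc ((D * (K + 1) : ℕ) : ℝ) * ((Fintype.card W : ℝ) ^ 2 * (D : ℝ))
        ≤ ((D * (K + 1) : ℕ) : ℝ) * ((D : ℝ) ^ 2 * (D : ℝ)) := by gcongr
      _ = ((D ^ 4 * (K + 1) : ℕ) : ℝ) := by push_cast; ring
  refine (tcl_le_of_potentialsGE hT (by positivity) hT_ge).trans (Nat.cast_le.2 ?_)
  have hsum : ∑ v : T.Site, T.degree v.1 ≤ D :=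
    calc ∑ v : T.Site, T.degree v.1 ≤ ∑ v, T.degree v := by
          rw [Fintype.sum_eq_add_sum_subtype_ne _ T.sink]
          exact Nat.le_add_left _ _
      _ ≤ D := T.sum_degree_le.trans (by omega)
  calc D ^ 4 * (K + 1) * ∑ v : T.Site, T.degree v.1
      ≤ (2 * K + 2) ^ 4 * (K + 1) * (2 * K + 2) := by gcongr <;> omega
    _ = 32 * (K + 1) ^ 6 := by ring

end NetworkEquiv

theorem InTCLPoly.of_networkEquiv {V W : ℕ → Type*} [∀ n, Fintype (V n)] [∀ n, DecidableEq (V n)]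
    [∀ n, Fintype (W n)] [∀ n, DecidableEq (W n)]
    {A : ∀ n, SinkGraph (V n)} {B : ∀ n, SinkGraph (W n)}
    (hA : ∀ n, (A n).IsConnected) (hB : ∀ n, (B n).IsConnected)
    (hAO : ∀ n, (A n).OrdinaryConnected) (hAP : PolySize A) (hBP : PolySize B)
    (h : ∀ n, (A n).NetworkEquiv (B n)) (hT : InTCLPoly A) : InTCLPoly B := by
  have hbound : IsPolyBounded _ := (IsPolyBounded.sup hT hAP.isPolyBounded).sup hBP.isPolyBounded
  refine hbound.of_forall_le 32 6 fun n K hK => ?_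
  simp only [Pi.sup_apply, sup_le_iff, Nat.cast_le] at hK
  exact (h n).tcl_le (hA n) (hAO n).preconnected (hB n) hK.1.1 hK.1.2 hK.2

theorem isConnected_of_preconnected {V : Type*} {S : SinkGraph V}
    (hO : (S.adjGraph.induce {v | v ≠ S.sink}).Preconnected)
    (hb : (∃ v, v ≠ S.sink) → ∃ b, 0 < S.mult b S.sink) : S.IsConnected := by
  have hreach : ∀ v, S.adjGraph.Reachable v S.sink := by
    intro v
    rcases eq_or_ne v S.sink with rfl | hv
    · exact .rfl
    obtain ⟨b, hb⟩ := hb ⟨v, hv⟩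
    have hvb : S.adjGraph.Reachable v b :=
      (hO ⟨v, hv⟩ ⟨b, ne_sink_of_mult_sink_pos hb⟩).map (SimpleGraph.Embedding.induce _).toHom
    exact hvb.trans (SimpleGraph.Adj.reachable hb)
  have : Nonempty V := ⟨S.sink⟩
  exact .mk fun u v => (hreach u).trans (hreach v).symm

theorem ofSites_congr {X : Type*} {m m' : X → X → ℕ} {t t' : X → ℕ}
    {hm : ∀ x y, m x y = m y x} {h0 : ∀ x, m x x = 0} {hm' : ∀ x y, m' x y = m' y x}
    {h0' : ∀ x, m' x x = 0} (h : ∀ x y, m x y = m' x y) (ht : ∀ x, t x = t' x) :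
    ofSites m t hm h0 = ofSites m' t' hm' h0' := by
  obtain rfl : m = m' := funext fun x => funext (h x)
  obtain rfl : t = t' := funext ht
  rfl

end SinkGraph

section Lattice

open Finset SinkGraph

theorem card_starLeaves (q : ℤ × ℤ) : (starLeaves q).card = 3 := by
  rw [starLeaves, card_eq_three]
  exact ⟨_, _, _, by simp, by simp, by simp, rfl⟩

theorem card_starCentres (p : ℤ × ℤ) : (starCentres p).card = 3 := by
  rw [starCentres, card_eq_three]
  exact ⟨_, _, _, by simp [eq_sub_iff_add_eq], by simp [eq_sub_iff_add_eq], by simp, rfl⟩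

theorem card_honeycombNbrs (x : HoneycombSite) : (honeycombNbrs x).card = 3 := by
  rcases x with p | q
  · rw [honeycombNbrs, card_map, card_starCentres]
  · rw [honeycombNbrs, card_map, card_starLeaves]

theorem inr_mem_honeycombNbrs_inl {p q : ℤ × ℤ} :
    Sum.inr q ∈ honeycombNbrs (Sum.inl p) ↔ p ∈ starLeaves q := by
  simp [honeycombNbrs, mem_starCentres_iff]

theorem inl_mem_honeycombNbrs_inr {p q : ℤ × ℤ} :
    Sum.inl p ∈ honeycombNbrs (Sum.inr q) ↔ p ∈ starLeaves q := by
  simp [honeycombNbrs]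

theorem eq_of_mem_starLeaves {p p' q q' : ℤ × ℤ} (hne : p ≠ p') (hp : p ∈ starLeaves q)
    (hp' : p' ∈ starLeaves q) (hpq' : p ∈ starLeaves q') (hpq'' : p' ∈ starLeaves q') :
    q = q' := by
  obtain ⟨a, b⟩ := p
  obtain ⟨a', b'⟩ := p'
  obtain ⟨c, d⟩ := q
  obtain ⟨c', d'⟩ := q'
  simp only [starLeaves, mem_insert, mem_singleton, Prod.mk.injEq, Prod.mk_add_mk, ne_eq] at *
  omega

theorem mem_triangularNbrs_iff {p p' : ℤ × ℤ} :
    p' ∈ triangularNbrs p ↔ p' ≠ p ∧ ∃ q ∈ starCentres p, p' ∈ starLeaves q := by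
  obtain ⟨a, b⟩ := p
  obtain ⟨a', b'⟩ := p'
  simp only [triangularNbrs, starLeaves, starCentres, mem_insert, mem_singleton, Prod.mk.injEq,
    Prod.mk_add_mk, Prod.mk_sub_mk, ne_eq, exists_eq_or_imp, exists_eq_left]
  omega

theorem triangularNbrs_eq_biUnion (p : ℤ × ℤ) :
    triangularNbrs p = (starCentres p).biUnion fun q => (starLeaves q).erase p := by
  ext p'
  simp only [mem_triangularNbrs_iff, mem_biUnion, mem_erase]
  tauto

section HoneycombSection

variable {F : Finset HoneycombSite}

/-! ### Connectivity of the lattice sandpiles -/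

theorem honeycombSandpile_ordinaryConnected
    (hF : (honeycomb.induce (F : Set HoneycombSite)).Connected) :
    (honeycombSandpile F).OrdinaryConnected := by
  let f : honeycomb.induce (F : Set HoneycombSite) →g
      (honeycombSandpile F).adjGraph.induce {v | v ≠ (honeycombSandpile F).sink} :=
    { toFun := fun x => ⟨some ⟨x.1, x.2⟩, Option.some_ne_none _⟩
      map_rel' := fun {x y} (hxy : y.1 ∈ honeycombNbrs x.1) =>
        Nat.pos_of_ne_zero (ite_ne_right_iff.2 ⟨hxy, one_ne_zero⟩) }
  refine SimpleGraph.Connected.map f ?_ hF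
  rintro ⟨_ | x, hx⟩
  · exact absurd rfl hx
  · exact ⟨⟨x.1, x.2⟩, rfl⟩

theorem exists_mem_honeycombNbrs_notMem (hF : F.Nonempty) :
    ∃ x ∈ F, ∃ y ∈ honeycombNbrs x, y ∉ F := by
  let height : HoneycombSite → ℤ := Sum.elim (fun p => 2 * p.1) fun q => 2 * q.1 + 1
  obtain ⟨x, hx, hmax⟩ := exists_max_image F height hF
  suffices h : ∃ y ∈ honeycombNbrs x, height x < height y by
    obtain ⟨y, hy, hxy⟩ := h
    exact ⟨x, hx, y, hy, fun hyF => (hmax y hyF).not_gt hxy⟩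
  rcases x with p | q
  · exact ⟨Sum.inr p, by simp [inr_mem_honeycombNbrs_inl, starLeaves], by simp [height]⟩
  · exact ⟨Sum.inl (q + (1, 0)), by simp [inl_mem_honeycombNbrs_inr, starLeaves],
      by simp [height, mul_add]⟩

theorem honeycombSandpile_isConnected
    (hF : (honeycomb.induce (F : Set HoneycombSite)).Connected) :
    (honeycombSandpile F).IsConnected := by
  refine isConnected_of_preconnected (honeycombSandpile_ordinaryConnected hF).preconnected
    fun _ => ?_
  obtain ⟨z⟩ := hF.nonempty
  obtain ⟨x, hx, y, hy, hyF⟩ := exists_mem_honeycombNbrs_notMem ⟨z.1, z.2⟩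
  exact ⟨some ⟨x, hx⟩, card_pos.2 ⟨y, mem_filter.2 ⟨hy, hyF⟩⟩⟩

theorem starDeltaSandpile_mult_sink (r : ℕ) (v : F.toLeft) :
    (starDeltaSandpile r F).mult (some v) (starDeltaSandpile r F).sink =
      ∑ q ∈ starCentres v.1,
        if q ∈ F.toRight then ((starLeaves q).filter (· ∉ F.toLeft)).card else r :=
  rfl

theorem starDeltaSandpile_adj {r : ℕ} {u v : F.toLeft} (hne : u ≠ v) {q : ℤ × ℤ}
    (hq : q ∈ F.toRight) (hu : u.1 ∈ starLeaves q) (hv : v.1 ∈ starLeaves q) :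
    (starDeltaSandpile r F).adjGraph.Adj (some u) (some v) := by
  change 0 < if u = v then 0 else _
  rw [if_neg hne]
  exact card_pos.2 ⟨q, mem_filter.2 ⟨hq, hu, hv⟩⟩

theorem exists_reachable_starDeltaSandpile (r : ℕ) {x y : HoneycombSite} (hx : x ∈ F) (hy : y ∈ F)
    (hxy : y ∈ honeycombNbrs x) {u : F.toLeft}
    (hux : x = Sum.inl u.1 ∨ x ∈ honeycombNbrs (Sum.inl u.1)) :
    ∃ v : F.toLeft, (y = Sum.inl v.1 ∨ y ∈ honeycombNbrs (Sum.inl v.1)) ∧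
      ((starDeltaSandpile r F).adjGraph.induce {v | v ≠ (starDeltaSandpile r F).sink}).Reachable
        ⟨some u, Option.some_ne_none _⟩ ⟨some v, Option.some_ne_none _⟩ := by
  rcases hux with rfl | hux
  · exact ⟨u, .inr hxy, .rfl⟩
  obtain ⟨q, huq, rfl⟩ := mem_map.1 hux
  obtain ⟨p, hpq, rfl⟩ := mem_map.1 hxy
  refine ⟨⟨p, mem_toLeft.2 hy⟩, .inl rfl, ?_⟩
  rcases eq_or_ne u ⟨p, mem_toLeft.2 hy⟩ with rfl | hup
  · exact .rfl
  · exact SimpleGraph.Adj.reachable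
      (starDeltaSandpile_adj hup (mem_toRight.2 hx) ((mem_starCentres_iff _ _).1 huq) hpq)

theorem starDeltaSandpile_preconnected (r : ℕ)
    (hF : (honeycomb.induce (F : Set HoneycombSite)).Preconnected) :
    ((starDeltaSandpile r F).adjGraph.induce
      {v | v ≠ (starDeltaSandpile r F).sink}).Preconnected := by
  rintro ⟨_ | u, hu⟩ ⟨_ | v, hv⟩
  iterate 2 exact absurd rfl hu
  · exact absurd rfl hv
  suffices hnear : ∀ {x y : (F : Set HoneycombSite)},
      (honeycomb.induce (F : Set HoneycombSite)).Walk x y → ∀ u : F.toLeft,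
      (x.1 = Sum.inl u.1 ∨ x.1 ∈ honeycombNbrs (Sum.inl u.1)) → y.1 = Sum.inl v.1 →
      ((starDeltaSandpile r F).adjGraph.induce {v | v ≠ (starDeltaSandpile r F).sink}).Reachable
        ⟨some u, Option.some_ne_none _⟩ ⟨some v, hv⟩ by
    obtain ⟨W⟩ := hF ⟨Sum.inl u.1, mem_toLeft.1 u.2⟩ ⟨Sum.inl v.1, mem_toLeft.1 v.2⟩
    exact hnear W u (.inl rfl) rfl
  intro x y W
  induction W with
  | nil =>
    rintro u (hxu | hxu) hxv
    · obtain rfl : u = v := Subtype.ext (Sum.inl_injective (hxu.symm.trans hxv))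
      exact .rfl
    · simp [hxv, honeycombNbrs] at hxu
  | cons hxy _ ih =>
    intro u hxu hyv
    obtain ⟨u', hu', hreach⟩ :=
      exists_reachable_starDeltaSandpile r (Subtype.prop _) (Subtype.prop _) hxy hxu
    exact hreach.trans (ih u' hu' hyv)

theorem exists_mem_add_notMem {P : Finset (ℤ × ℤ)} (hP : P.Nonempty) :
    ∃ p ∈ P, p + (1, 0) ∉ P := by
  obtain ⟨p, hp, hmax⟩ := exists_max_image P Prod.fst hP
  exact ⟨p, hp, fun hp' => by simpa using hmax _ hp'⟩

theorem starDeltaSandpile_isConnected {r : ℕ} (hr : 1 ≤ r)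
    (hF : (honeycomb.induce (F : Set HoneycombSite)).Preconnected) :
    (starDeltaSandpile r F).IsConnected := by
  refine isConnected_of_preconnected (starDeltaSandpile_preconnected r hF) ?_
  rintro ⟨_ | v, hv⟩
  · exact absurd rfl hv
  obtain ⟨p, hp, hp'⟩ := exists_mem_add_notMem ⟨v.1, v.2⟩
  refine ⟨some ⟨p, hp⟩, ?_⟩
  rw [starDeltaSandpile_mult_sink]
  refine sum_pos' (fun _ _ => Nat.zero_le _) ⟨p, by simp [starCentres], ?_⟩
  split_ifs
  · exact card_pos.2 ⟨_, mem_filter.2 ⟨by simp [starLeaves], hp'⟩⟩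
  · exact hr

/-! ### The star-delta transformation preserves potentials -/

/-- The lattice point `y` as a vertex of a sandpile with site set `F`: the points outside `F` are
the sink. -/
def siteOrSink {α : Type*} [DecidableEq α] (F : Finset α) (y : α) : Option F :=
  if h : y ∈ F then some ⟨y, h⟩ else none

theorem siteOrSink_of_mem {α : Type*} [DecidableEq α] {F : Finset α} {y : α} (h : y ∈ F) :
    siteOrSink F y = some ⟨y, h⟩ :=
  dif_pos h

theorem siteOrSink_of_notMem {α : Type*} [DecidableEq α] {F : Finset α} {y : α} (h : y ∉ F) :
    siteOrSink F y = none :=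
  dif_neg h

theorem sum_siteOrSink {α R : Type*} [DecidableEq α] [CommSemiring R] (F A : Finset α)
    (φ : Option F → R) :
    ∑ y ∈ A, φ (siteOrSink F y) =
      (A.filter (· ∉ F)).card * φ none + ∑ y : F, if y.1 ∈ A then φ (some y) else 0 := by
  rw [← sum_filter_not_add_sum_filter A (· ∈ F)]
  congr 1
  · rw [sum_congr rfl fun y hy => by rw [siteOrSink_of_notMem (mem_filter.1 hy).2], sum_const,
      nsmul_eq_mul]
  · calc ∑ y ∈ A with y ∈ F, φ (siteOrSink F y)
        = ∑ y ∈ F with y ∈ A, φ (siteOrSink F y) := by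
          rw [filter_mem_eq_inter, filter_mem_eq_inter, inter_comm]
      _ = ∑ y : F, if y.1 ∈ A then φ (siteOrSink F y) else 0 := by
          rw [sum_filter, ← sum_coe_sort F]
      _ = _ := by simp only [siteOrSink_of_mem (Subtype.prop _)]

theorem honeycombSandpile_sum_mult {R : Type*} [CommSemiring R] (x : F) (φ : Option F → R) :
    ∑ y, ((honeycombSandpile F).mult (some x) y : R) * φ y =
      ∑ y ∈ honeycombNbrs x.1, φ (siteOrSink F y) := by
  rw [Fintype.sum_option, sum_siteOrSink]
  change (((honeycombNbrs x.1).filter (· ∉ F)).card : R) * φ none +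
    ∑ y : F, ((if y.1 ∈ honeycombNbrs x.1 then 1 else 0 : ℕ) : R) * φ (some y) = _
  simp only [Nat.cast_ite, Nat.cast_one, Nat.cast_zero, ite_mul, one_mul, zero_mul]

theorem honeycombSandpile_degree {v : Option F} (hv : v ≠ (honeycombSandpile F).sink) :
    (honeycombSandpile F).degree v = 3 := by
  obtain _ | x := v
  · exact absurd rfl hv
  simpa [degree, card_honeycombNbrs] using honeycombSandpile_sum_mult x (R := ℕ) fun _ => 1

theorem starDeltaSandpile_mult_site (r : ℕ) (u v : F.toLeft) :
    (starDeltaSandpile r F).mult (some v) (some u) =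
      ∑ q ∈ starCentres v.1,
        if q ∈ F.toRight then if u.1 ∈ (starLeaves q).erase v.1 then 1 else 0 else 0 := by
  change (if v = u then 0 else
    (F.toRight.filter fun q => v.1 ∈ starLeaves q ∧ u.1 ∈ starLeaves q).card) = _
  rcases eq_or_ne v u with rfl | hvu
  · simp
  have huv : u.1 ≠ v.1 := fun h => hvu (Subtype.ext h.symm)
  rw [if_neg hvu, ← sum_filter, ← sum_filter, filter_filter, ← card_eq_sum_ones]
  congr 1
  ext q
  simp only [mem_filter, mem_starCentres_iff, mem_erase]
  tauto

theorem starDeltaSandpile_sum_mult {R : Type*} [CommSemiring R] (r : ℕ) (v : F.toLeft)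
    (φ : Option F.toLeft → R) :
    ∑ u, ((starDeltaSandpile r F).mult (some v) u : R) * φ u =
      ∑ q ∈ starCentres v.1, if q ∈ F.toRight then
        ∑ u ∈ (starLeaves q).erase v.1, φ (siteOrSink F.toLeft u) else r * φ none := by
  have hsink : (starDeltaSandpile r F).mult (some v) none = _ := starDeltaSandpile_mult_sink r v
  simp only [Fintype.sum_option, hsink, starDeltaSandpile_mult_site, Nat.cast_sum, sum_mul]
  rw [sum_comm, ← sum_add_distrib]
  refine sum_congr rfl fun q _ => ?_
  by_cases hq : q ∈ F.toRight
  · have hfilter : ((starLeaves q).erase v.1).filter (· ∉ F.toLeft) =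
        (starLeaves q).filter (· ∉ F.toLeft) := by
      rw [filter_erase, erase_eq_of_notMem (by simp [mem_toLeft.1 v.2])]
    simp only [if_pos hq, sum_siteOrSink, hfilter, Nat.cast_ite, Nat.cast_one, Nat.cast_zero,
      ite_mul, one_mul, zero_mul]
  · simp only [if_neg hq, Nat.cast_zero, zero_mul, sum_const_zero, add_zero]

theorem starDeltaSandpile_degree (r : ℕ) (v : F.toLeft) :
    (starDeltaSandpile r F).degree (some v) =
      ∑ q ∈ starCentres v.1, if q ∈ F.toRight then 2 else r := by
  have hsum := starDeltaSandpile_sum_mult (R := ℕ) r v fun _ => 1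
  simp only [Nat.cast_id, mul_one, sum_const, smul_eq_mul] at hsum
  refine hsum.trans (sum_congr rfl fun q hq => ?_)
  rw [card_erase_of_mem ((mem_starCentres_iff _ _).1 hq), card_starLeaves]

theorem starDeltaSandpile_degree_le {r : ℕ} {v : Option F.toLeft}
    (hv : v ≠ (starDeltaSandpile r F).sink) : (starDeltaSandpile r F).degree v ≤ 6 + 3 * r := by
  obtain _ | v := v
  · exact absurd rfl hv
  rw [starDeltaSandpile_degree]
  refine (sum_le_card_nsmul _ _ (2 + r) fun q _ => ?_).trans ?_
  · split_ifs <;> omega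
  · rw [card_starCentres, smul_eq_mul]
    omega

theorem two_le_starDeltaSandpile_degree {r : ℕ} (hr : 1 ≤ r) {v : Option F.toLeft}
    (hv : v ≠ (starDeltaSandpile r F).sink) : 2 ≤ (starDeltaSandpile r F).degree v := by
  obtain _ | v := v
  · exact absurd rfl hv
  rw [starDeltaSandpile_degree]
  refine le_trans ?_ (card_nsmul_le_sum _ _ 1 fun q _ => ?_)
  · rw [card_starCentres, smul_eq_mul]
    omega
  · split_ifs <;> omega

/-- A vertex of the star-delta sandpile as a vertex of the honeycomb sandpile. -/
def leftVertex (F : Finset HoneycombSite) : Option F.toLeft → Option F :=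
  Option.map fun v => ⟨Sum.inl v.1, mem_toLeft.1 v.2⟩

theorem leftVertex_siteOrSink (p : ℤ × ℤ) :
    leftVertex F (siteOrSink F.toLeft p) = siteOrSink F (Sum.inl p) := by
  by_cases h : Sum.inl p ∈ F
  · rw [siteOrSink_of_mem h, siteOrSink_of_mem (mem_toLeft.2 h)]
    rfl
  · rw [siteOrSink_of_notMem h, siteOrSink_of_notMem fun h' => h (mem_toLeft.1 h')]
    rfl

theorem leftVertex_injective : Function.Injective (leftVertex F) :=
  Option.map_injective fun _ _ h => Subtype.ext (Sum.inl_injective (Subtype.ext_iff.1 h))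

theorem sum_honeycombNbrs_of_isPotential {w : Option F} {p : Option F → ℝ}
    (hp : (honeycombSandpile F).IsPotential w p) {x : F} (hxw : some x ≠ w) :
    ∑ y ∈ honeycombNbrs x.1, p (siteOrSink F y) = 3 * p (some x) := by
  have hx : some x ≠ (honeycombSandpile F).sink := Option.some_ne_none _
  rw [← honeycombSandpile_sum_mult, hp.2.2 _ hx hxw, honeycombSandpile_degree hx, Nat.cast_ofNat]

-- Harmonicity at the centre `q` makes its potential the mean of the potentials of the leaves.
theorem sum_star_of_isPotential {w : Option F} {p : Option F → ℝ}
    (hp : (honeycombSandpile F).IsPotential w p) {q : ℤ × ℤ} (hqw : siteOrSink F (Sum.inr q) ≠ w)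
    {v : ℤ × ℤ} (hvq : v ∈ starLeaves q) :
    (if q ∈ F.toRight then ∑ u ∈ (starLeaves q).erase v, p (siteOrSink F (Sum.inl u))
      else 3 * p none) =
      (if q ∈ F.toRight then 2 else 3) * p (siteOrSink F (Sum.inl v)) +
        3 * (p (siteOrSink F (Sum.inr q)) - p (siteOrSink F (Sum.inl v))) := by
  by_cases hq : Sum.inr q ∈ F
  · have hsite := siteOrSink_of_mem hq
    rw [hsite] at hqw ⊢
    have hcentre : ∑ u ∈ starLeaves q, p (siteOrSink F (Sum.inl u)) = 3 * p (some ⟨_, hq⟩) := by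
      simpa [honeycombNbrs] using sum_honeycombNbrs_of_isPotential hp hqw
    rw [if_pos (mem_toRight.2 hq), if_pos (mem_toRight.2 hq)]
    linarith [add_sum_erase (starLeaves q) (fun u => p (siteOrSink F (Sum.inl u))) hvq]
  · have hq' : q ∉ F.toRight := fun h => hq (mem_toRight.1 h)
    rw [if_neg hq', if_neg hq', siteOrSink_of_notMem hq, show p none = 0 from hp.1]
    ring

theorem starDeltaSandpile_isPotential {w : F.toLeft} {p : Option F → ℝ}
    (hp : (honeycombSandpile F).IsPotential (leftVertex F (some w)) p) :
    (starDeltaSandpile 3 F).IsPotential (some w) (p ∘ leftVertex F) := by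
  refine ⟨hp.1, hp.2.1, ?_⟩
  rintro (_ | v) hv hvw
  · exact absurd rfl hv
  let P : HoneycombSite → ℝ := fun y => p (siteOrSink F y)
  have hPv : p (leftVertex F (some v)) = P (Sum.inl v.1) := by
    simp only [P, ← leftVertex_siteOrSink, siteOrSink_of_mem v.2]
  have hleaf : ∑ q ∈ starCentres v.1, P (Sum.inr q) = 3 * P (Sum.inl v.1) := by
    have hne := leftVertex_injective.ne hvw
    have hsum := sum_honeycombNbrs_of_isPotential hp hne
    rw [honeycombNbrs, sum_map] at hsum
    exact hsum.trans (congrArg (3 * ·) hPv)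
  have hstar (q : ℤ × ℤ) (hq : q ∈ starCentres v.1) := sum_star_of_isPotential hp (q := q)
    (by rw [leftVertex, siteOrSink]; split_ifs <;> simp) ((mem_starCentres_iff _ _).1 hq)
  calc ∑ u, ((starDeltaSandpile 3 F).mult (some v) u : ℝ) * p (leftVertex F u)
      = ∑ q ∈ starCentres v.1, ((if q ∈ F.toRight then 2 else 3) * P (Sum.inl v.1) +
          3 * (P (Sum.inr q) - P (Sum.inl v.1))) := by
        rw [starDeltaSandpile_sum_mult 3 v fun u => p (leftVertex F u), ← sum_congr rfl hstar]
        simp only [leftVertex_siteOrSink]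
        rfl
    _ = (starDeltaSandpile 3 F).degree (some v) * P (Sum.inl v.1) := by
        rw [sum_add_distrib, ← sum_mul, ← mul_sum, sum_sub_distrib, hleaf, sum_const,
          card_starCentres, starDeltaSandpile_degree]
        push_cast
        ring
    _ = (starDeltaSandpile 3 F).degree (some v) * p (leftVertex F (some v)) := by rw [hPv]

/-! ### Comparison of the transience classes -/

theorem honeycombSandpile_potentialsGE_starDelta
    (hF : (honeycomb.induce (F : Set HoneycombSite)).Connected) {ε : ℝ}
    (h : (honeycombSandpile F).PotentialsGE ε) : (starDeltaSandpile 3 F).PotentialsGE ε := by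
  intro w v q hv hq
  obtain _ | w := w
  · exact absurd rfl hq.ne_sink
  obtain _ | v := v
  · exact absurd rfl hv
  obtain ⟨p, hp⟩ := exists_isPotential (honeycombSandpile_isConnected hF)
    (w := leftVertex F (some w)) (Option.some_ne_none _)
  rw [hq.unique (starDeltaSandpile_isConnected (by norm_num) hF.preconnected)
    (starDeltaSandpile_isPotential hp)]
  exact h (Option.some_ne_none _) hp

theorem starDeltaSandpile_agreeOffSink (r s : ℕ) :
    (starDeltaSandpile r F).AgreeOffSink (starDeltaSandpile s F) where
  sink_eq := rfl
  mult_eq u v hu hv := by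
    obtain _ | u := u
    · exact absurd rfl hu
    obtain _ | v := v
    · exact absurd rfl hv
    rfl

theorem starDeltaSandpile_mult_sink_mono {r s : ℕ} (hrs : r ≤ s) (v : Option F.toLeft) :
    (starDeltaSandpile r F).mult v (starDeltaSandpile r F).sink ≤
      (starDeltaSandpile s F).mult v (starDeltaSandpile s F).sink := by
  obtain _ | v := v
  · exact le_rfl
  rw [starDeltaSandpile_mult_sink, starDeltaSandpile_mult_sink]
  gcongr
  split_ifs
  · exact le_rfl
  · exact hrs

theorem starDeltaSandpile_mult_sink_le {s : ℕ} (hs : 1 ≤ s) (v : Option F.toLeft) :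
    (starDeltaSandpile s F).mult v (starDeltaSandpile s F).sink ≤
      s * (starDeltaSandpile 1 F).mult v (starDeltaSandpile 1 F).sink := by
  obtain _ | v := v
  · exact Nat.zero_le _
  rw [starDeltaSandpile_mult_sink, starDeltaSandpile_mult_sink, mul_sum]
  gcongr
  split_ifs
  · exact Nat.le_mul_of_pos_left _ hs
  · rw [mul_one]

theorem starDeltaSandpile_potentialsGE_pow {r s : ℕ} (hr : 1 ≤ r) (hs : 1 ≤ s)
    (hF : (honeycomb.induce (F : Set HoneycombSite)).Preconnected) {ε : ℝ} (hε : 0 ≤ ε)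
    (h : (starDeltaSandpile r F).PotentialsGE ε) :
    (starDeltaSandpile s F).PotentialsGE (ε ^ s) := by
  intro w v q hv hq
  have hT {t : ℕ} (ht : 1 ≤ t) := starDeltaSandpile_isConnected ht hF
  obtain ⟨p, hp⟩ := exists_isPotential (hT hr) (w := w) hq.ne_sink
  obtain ⟨p₁, hp₁⟩ := exists_isPotential (hT le_rfl) (w := w) hq.ne_sink
  have hpp₁ : p v ≤ p₁ v := hp₁.le_of_sink_mult_le (hT le_rfl) (hT hr)
    (starDeltaSandpile_agreeOffSink 1 r) (starDeltaSandpile_mult_sink_mono hr) hp v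
  calc ε ^ s ≤ p₁ v ^ s := by
        gcongr
        exact (h hv hp).trans hpp₁
    _ ≤ q v := hp₁.pow_le_of_sink_mult_le (hT le_rfl) (hT hs) (starDeltaSandpile_agreeOffSink 1 s)
        (by omega) (starDeltaSandpile_mult_sink_le hs) hq v

theorem exists_leftVertex_eq_or_adj
    (hF : (honeycomb.induce (F : Set HoneycombSite)).Preconnected) [Nontrivial F] (x : F) :
    ∃ b : F.toLeft, leftVertex F (some b) = some x ∨
      0 < (honeycombSandpile F).mult (some x) (leftVertex F (some b)) := by
  obtain ⟨b | q, hx⟩ := x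
  · exact ⟨⟨b, mem_toLeft.2 hx⟩, .inl rfl⟩
  have : Nontrivial (F : Set HoneycombSite) := ‹_›
  obtain ⟨⟨y, hy⟩, hqy⟩ := hF.exists_adj_of_nontrivial ⟨Sum.inr q, hx⟩
  replace hqy : y ∈ honeycombNbrs (Sum.inr q) := hqy
  obtain ⟨b, -, rfl⟩ := mem_map.1 hqy
  exact ⟨⟨b, mem_toLeft.2 hy⟩, .inr (Nat.pos_of_ne_zero (ite_ne_right_iff.2 ⟨hqy, one_ne_zero⟩))⟩

theorem le_three_mul_of_isPotential
    (hF : (honeycomb.induce (F : Set HoneycombSite)).Connected) {w x y : Option F}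
    {p : Option F → ℝ} (hp : (honeycombSandpile F).IsPotential w p)
    (hx : x ≠ (honeycombSandpile F).sink)
    (hxy : y = x ∨ 0 < (honeycombSandpile F).mult x y) : p y ≤ 3 * p x := by
  have hH := honeycombSandpile_isConnected hF
  rcases hxy with rfl | hxy
  · linarith [hp.nonneg hH y]
  · simpa [honeycombSandpile_degree hx] using hp.le_degree_mul hH hx hxy

theorem honeycombSandpile_potentialsGE_of_starDelta
    (hF : (honeycomb.induce (F : Set HoneycombSite)).Connected) {ε : ℝ} (hε0 : 0 ≤ ε)
    (hε1 : ε ≤ 1) (h : (starDeltaSandpile 3 F).PotentialsGE ε) :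
    (honeycombSandpile F).PotentialsGE (ε / 9) := by
  intro w v p hv hp
  have hH := honeycombSandpile_isConnected hF
  obtain _ | w := w
  · exact absurd rfl hp.ne_sink
  obtain _ | v := v
  · exact absurd rfl hv
  rcases subsingleton_or_nontrivial F with hsub | hnt
  · rw [Subsingleton.elim v w, hp.2.1]
    linarith
  obtain ⟨a, haw⟩ := exists_leftVertex_eq_or_adj hF.preconnected w
  obtain ⟨b, hbv⟩ := exists_leftVertex_eq_or_adj hF.preconnected v
  obtain ⟨P, hP⟩ := exists_isPotential hH (w := leftVertex F (some a)) (Option.some_ne_none _)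
  have hPb : ε ≤ P (leftVertex F (some b)) :=
    h (Option.some_ne_none _) (starDeltaSandpile_isPotential hP)
  have hPv : P (leftVertex F (some b)) ≤ 3 * P (some v) := le_three_mul_of_isPotential hF hP hv hbv
  have hpa : p (some w) ≤ 3 * p (leftVertex F (some a)) := by
    refine le_three_mul_of_isPotential hF hp (Option.some_ne_none _) (haw.imp Eq.symm ?_)
    exact fun h => by rwa [mult_comm]
  rw [hp.2.1] at hpa
  calc ε / 9 ≤ 1 / 3 * (ε / 3) := by linarith
    _ ≤ p (leftVertex F (some a)) * P (some v) := by
        gcongr <;> linarith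
    _ ≤ p (some v) := hp.mul_le hH hP (some v)

theorem card_honeycombSandpile_site : Fintype.card (honeycombSandpile F).Site = F.card :=
  (Set.card_ne_eq _).trans (by rw [Fintype.card_option, Fintype.card_coe, Nat.add_sub_cancel])

theorem card_starDeltaSandpile_site (r : ℕ) :
    Fintype.card (starDeltaSandpile r F).Site = F.toLeft.card :=
  (Set.card_ne_eq _).trans (by rw [Fintype.card_option, Fintype.card_coe, Nat.add_sub_cancel])

theorem card_le_four_mul_card_toLeft_add_one
    (hF : (honeycomb.induce (F : Set HoneycombSite)).Preconnected) :
    F.card ≤ 4 * F.toLeft.card + 1 := by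
  rcases subsingleton_or_nontrivial F with hsub | hnt
  · have : F.card ≤ 1 := by rwa [← Fintype.card_coe, Fintype.card_le_one_iff_subsingleton]
    omega
  have hcentres : F.toRight ⊆ F.toLeft.biUnion starCentres := by
    intro q hq
    obtain ⟨b, hb | hb⟩ := exists_leftVertex_eq_or_adj hF ⟨Sum.inr q, mem_toRight.1 hq⟩
    · simp [leftVertex] at hb
    · have hbq : Sum.inl b.1 ∈ honeycombNbrs (Sum.inr q) := by
        by_contra hbq
        exact hb.ne' (if_neg hbq)
      exact mem_biUnion.2
        ⟨b.1, b.2, (mem_starCentres_iff _ _).2 (inl_mem_honeycombNbrs_inr.1 hbq)⟩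
  have hcard := (card_le_card hcentres).trans
    (card_biUnion_le_card_mul _ _ 3 fun p _ => (card_starCentres p).le)
  have := card_toLeft_add_card_toRight (u := F)
  omega

theorem tcl_starDeltaSandpile_le {r : ℕ} (hr : 1 ≤ r)
    (hF : (honeycomb.induce (F : Set HoneycombSite)).Connected) {K : ℕ}
    (hK : (honeycombSandpile F).tcl ≤ (K : ℕ∞)) :
    (starDeltaSandpile r F).tcl ≤ ((3 ^ r * (6 + 3 * r) * 2 * (K + 1) ^ (r + 1) : ℕ) : ℕ∞) := by
  have hH := honeycombSandpile_isConnected hF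
  have hO := (honeycombSandpile_ordinaryConnected hF).preconnected
  have hdeg (v : (honeycombSandpile F).Site) := honeycombSandpile_degree v.2
  have hcard : F.toLeft.card ≤ K + 2 := by
    refine card_toLeft_le.trans ?_
    rw [← card_honeycombSandpile_site]
    exact card_site_le hO (fun v => by rw [hdeg]; norm_num) hK
  have hH_ge : (honeycombSandpile F).PotentialsGE ((3 * (K + 1) : ℕ) : ℝ)⁻¹ :=
    potentialsGE_of_tcl_le hH hO hK fun v hv => (honeycombSandpile_degree hv).le
  have hT_ge : (starDeltaSandpile r F).PotentialsGE (((3 * (K + 1)) ^ r : ℕ) : ℝ)⁻¹ := by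
    rw [Nat.cast_pow, ← inv_pow]
    exact starDeltaSandpile_potentialsGE_pow (by norm_num) hr hF.preconnected (by positivity)
      (honeycombSandpile_potentialsGE_starDelta hF hH_ge)
  refine (tcl_le_of_potentialsGE (starDeltaSandpile_isConnected hr hF.preconnected)
    (by positivity) hT_ge).trans (Nat.cast_le.2 ?_)
  calc (3 * (K + 1)) ^ r * ∑ v : (starDeltaSandpile r F).Site, (starDeltaSandpile r F).degree v.1
      ≤ (3 * (K + 1)) ^ r * (F.toLeft.card * (6 + 3 * r)) := by
        rw [← card_starDeltaSandpile_site r, ← card_univ]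
        gcongr
        exact sum_le_card_nsmul _ _ _ fun v _ => starDeltaSandpile_degree_le v.2
    _ ≤ (3 * (K + 1)) ^ r * ((2 * (K + 1)) * (6 + 3 * r)) := by
        gcongr
        omega
    _ = 3 ^ r * (6 + 3 * r) * 2 * (K + 1) ^ (r + 1) := by
        rw [mul_pow, pow_succ]
        ring

theorem tcl_honeycombSandpile_le {r : ℕ} (hr : 1 ≤ r)
    (hF : (honeycomb.induce (F : Set HoneycombSite)).Connected) {K : ℕ}
    (hK : (starDeltaSandpile r F).tcl ≤ (K : ℕ∞)) :
    (honeycombSandpile F).tcl ≤ ((243 * (6 + 3 * r) ^ 3 * (K + 1) ^ 4 : ℕ) : ℕ∞) := by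
  set D := 6 + 3 * r
  have hO := starDeltaSandpile_preconnected r hF.preconnected
  have hcard : F.card ≤ 9 * (K + 1) := by
    have hleft := card_site_le hO (fun v => two_le_starDeltaSandpile_degree hr v.2) hK
    rw [card_starDeltaSandpile_site] at hleft
    have := card_le_four_mul_card_toLeft_add_one hF.preconnected
    omega
  have hT_ge : (starDeltaSandpile r F).PotentialsGE ((D * (K + 1) : ℕ) : ℝ)⁻¹ :=
    potentialsGE_of_tcl_le (starDeltaSandpile_isConnected hr hF.preconnected) hO hK
      fun v hv => starDeltaSandpile_degree_le hv
  have hH_ge : (honeycombSandpile F).PotentialsGE ((9 * (D * (K + 1)) ^ 3 : ℕ) : ℝ)⁻¹ := by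
    rw [Nat.cast_mul, mul_comm, mul_inv, Nat.cast_pow, ← inv_pow]
    exact honeycombSandpile_potentialsGE_of_starDelta hF (by positivity)
      (pow_le_one₀ (by positivity) (Nat.cast_inv_le_one _))
      (starDeltaSandpile_potentialsGE_pow hr (by norm_num) hF.preconnected (by positivity) hT_ge)
  refine (tcl_le_of_potentialsGE (honeycombSandpile_isConnected hF) (by positivity)
    hH_ge).trans (Nat.cast_le.2 ?_)
  calc 9 * (D * (K + 1)) ^ 3 * ∑ v : (honeycombSandpile F).Site, (honeycombSandpile F).degree v.1
      = 9 * (D * (K + 1)) ^ 3 * (F.card * 3) := by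
        rw [sum_congr rfl fun v _ => honeycombSandpile_degree v.2, sum_const, card_univ,
          card_honeycombSandpile_site, smul_eq_mul]
    _ ≤ 9 * (D * (K + 1)) ^ 3 * (9 * (K + 1) * 3) := by gcongr
    _ = 243 * D ^ 3 * (K + 1) ^ 4 := by ring

theorem inTCLPoly_honeycombSandpile_iff {F : ℕ → Finset HoneycombSite}
    (hF : ∀ n, (honeycomb.induce (F n : Set HoneycombSite)).Connected) {r : ℕ} (hr : 1 ≤ r) :
    InTCLPoly (fun n => honeycombSandpile (F n)) ↔
      InTCLPoly (fun n => starDeltaSandpile r (F n)) :=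
  ⟨fun h => IsPolyBounded.of_forall_le h _ _ fun n _ => tcl_starDeltaSandpile_le hr (hF n),
    fun h => IsPolyBounded.of_forall_le h _ _ fun n _ => tcl_honeycombSandpile_le hr (hF n)⟩

end HoneycombSection

/-! ### The triangular lattice -/

section Triangular

variable {P Q : Finset (ℤ × ℤ)} {u v : ℤ × ℤ}

/-- Every star with at least two leaves in `P` has its centre in `Q`: the condition under which the
star-delta sandpile is a section of the triangular lattice. -/
def ContainsCentres (P Q : Finset (ℤ × ℤ)) : Prop :=
  ∀ ⦃u v q : ℤ × ℤ⦄, u ≠ v → u ∈ P → v ∈ P → u ∈ starLeaves q → v ∈ starLeaves q → q ∈ Q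

theorem containsCentres_of_two_le_card
    (hF : ∀ q : ℤ × ℤ, 2 ≤ ((starLeaves q).filter (· ∈ P)).card → q ∈ Q) :
    ContainsCentres P Q := by
  intro u v q huv hu hv huq hvq
  refine hF q (Nat.succ_le_of_lt (one_lt_card.2 ?_))
  exact ⟨u, mem_filter.2 ⟨huq, hu⟩, v, mem_filter.2 ⟨hvq, hv⟩, huv⟩

theorem ContainsCentres.card_filter_eq (h : ContainsCentres P Q) (hu : u ∈ P) (hv : v ∈ P)
    (huv : u ≠ v) :
    (Q.filter fun q => u ∈ starLeaves q ∧ v ∈ starLeaves q).card =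
      if v ∈ triangularNbrs u then 1 else 0 := by
  split_ifs with huv'
  · obtain ⟨-, q, hq, hvq⟩ := mem_triangularNbrs_iff.1 huv'
    rw [mem_starCentres_iff] at hq
    refine card_eq_one.2 ⟨q, eq_singleton_iff_unique_mem.2 ⟨?_, fun q' hq' => ?_⟩⟩
    · exact mem_filter.2 ⟨h huv hu hv hq hvq, hq, hvq⟩
    · obtain ⟨-, huq', hvq'⟩ := mem_filter.1 hq'
      exact eq_of_mem_starLeaves huv huq' hvq' hq hvq
  · refine card_eq_zero.2 (filter_eq_empty_iff.2 ?_)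
    rintro q - ⟨huq, hvq⟩
    exact huv' (mem_triangularNbrs_iff.2 ⟨huv.symm, q, (mem_starCentres_iff _ _).2 huq, hvq⟩)

theorem ContainsCentres.card_filter_notMem_triangularNbrs (h : ContainsCentres P Q) (hu : u ∈ P) :
    ((triangularNbrs u).filter (· ∉ P)).card =
      ∑ q ∈ starCentres u, if q ∈ Q then ((starLeaves q).filter (· ∉ P)).card else 2 := by
  rw [triangularNbrs_eq_biUnion, filter_biUnion, card_biUnion]
  · refine sum_congr rfl fun q hq => ?_
    rw [mem_starCentres_iff] at hq
    split_ifs with hqQ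
    · rw [filter_erase, erase_eq_of_notMem (by simp [hu])]
    · rw [filter_true_of_mem, card_erase_of_mem hq, card_starLeaves]
      intro x hx hxP
      exact hqQ (h (ne_of_mem_erase hx).symm hu hxP hq (mem_of_mem_erase hx))
  · intro q hq q' hq' hne
    rw [mem_coe, mem_starCentres_iff] at hq hq'
    refine disjoint_left.2 fun x hx hx' => hne ?_
    obtain ⟨hxu, hxq⟩ := mem_erase.1 (mem_filter.1 hx).1
    exact eq_of_mem_starLeaves hxu.symm hq hxq hq' (mem_of_mem_erase (mem_filter.1 hx').1)

end Triangular

theorem triangularSandpile_eq_starDeltaSandpile {F : Finset HoneycombSite}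
    (h : ContainsCentres F.toLeft F.toRight) :
    triangularSandpile F.toLeft = starDeltaSandpile 2 F := by
  refine ofSites_congr (fun u v => ?_)
    fun u => h.card_filter_notMem_triangularNbrs u.2
  rcases eq_or_ne u v with rfl | huv
  · rw [if_pos rfl, if_neg (triangularNbrs_self _)]
  · rw [if_neg huv, h.card_filter_eq u.2 v.2 (Subtype.coe_ne_coe.2 huv)]

end Lattice

theorem mainTheorem10 :
    -- network equivalent families of polynomial size
    (∀ {V : ℕ → Type*} {W : ℕ → Type*} [∀ n, Fintype (V n)] [∀ n, DecidableEq (V n)]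
        [∀ n, Fintype (W n)] [∀ n, DecidableEq (W n)]
        (A : ∀ n, SinkGraph (V n)) (B : ∀ n, SinkGraph (W n)),
      (∀ n, (A n).IsConnected) → (∀ n, (B n).IsConnected) →
      (∀ n, (A n).OrdinaryConnected) → (∀ n, (B n).OrdinaryConnected) →
      SinkGraph.PolySize A → SinkGraph.PolySize B →
      (∀ n, (A n).NetworkEquiv (B n)) →
      (SinkGraph.InTCLPoly A ↔ SinkGraph.InTCLPoly B)) ∧
    -- star-delta: the potentials at the common vertices do not change
    (∀ F : Finset HoneycombSite, (honeycomb.induce (F : Set HoneycombSite)).Connected →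
      ∀ (a : ℤ × ℤ) (ha : Sum.inl a ∈ F), ∃ (p : Option F → ℝ) (q : Option F.toLeft → ℝ),
        (honeycombSandpile F).IsPotential (some ⟨Sum.inl a, ha⟩) p ∧
        (starDeltaSandpile 3 F).IsPotential (some ⟨a, Finset.mem_toLeft.2 ha⟩) q ∧
        ∀ (b : ℤ × ℤ) (hb : Sum.inl b ∈ F),
          p (some ⟨Sum.inl b, hb⟩) = q (some ⟨b, Finset.mem_toLeft.2 hb⟩)) ∧
    -- honeycomb sandpiles and the triangular sandpiles obtained from them
    (∀ F : ℕ → Finset HoneycombSite,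
      (∀ n, (honeycomb.induce (F n : Set HoneycombSite)).Connected) →
      (∀ r : ℕ, 1 ≤ r →
        (SinkGraph.InTCLPoly (fun n => honeycombSandpile (F n)) ↔
          SinkGraph.InTCLPoly (fun n => starDeltaSandpile r (F n)))) ∧
      ((∀ n, ∀ q : ℤ × ℤ, 2 ≤ ((starLeaves q).filter (fun p => Sum.inl p ∈ F n)).card →
          Sum.inr q ∈ F n) →
        (SinkGraph.InTCLPoly (fun n => honeycombSandpile (F n)) ↔
          SinkGraph.InTCLPoly (fun n => triangularSandpile (F n).toLeft)))) := by
  refine ⟨?_, ?_, ?_⟩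
  · intro V W _ _ _ _ A B hA hB hAO hBO hAP hBP h
    exact ⟨SinkGraph.InTCLPoly.of_networkEquiv hA hB hAO hAP hBP h,
      SinkGraph.InTCLPoly.of_networkEquiv hB hA hBO hBP hAP fun n => (h n).symm⟩
  · intro F hF a ha
    obtain ⟨p, hp⟩ := SinkGraph.exists_isPotential (honeycombSandpile_isConnected hF)
      (w := some ⟨Sum.inl a, ha⟩) (Option.some_ne_none _)
    exact ⟨p, p ∘ leftVertex F, hp,
      starDeltaSandpile_isPotential (w := ⟨a, Finset.mem_toLeft.2 ha⟩) hp, fun _ _ => rfl⟩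
  · intro F hF
    refine ⟨fun r hr => inTCLPoly_honeycombSandpile_iff hF hr, fun hC => ?_⟩
    have hcentres (n : ℕ) : ContainsCentres (F n).toLeft (F n).toRight :=
      containsCentres_of_two_le_card fun q hq =>
        Finset.mem_toRight.2 (hC n q (by simpa only [Finset.mem_toLeft] using hq))
    rw [funext fun n => triangularSandpile_eq_starDeltaSandpile (hcentres n)]
    exact inTCLPoly_honeycombSandpile_iff hF (by norm_num)
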